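/- Let $(M,\tau)$ be a diffuse tracial von Neumann algebra, i.e. $M\subseteq B(H)$ is a von Neumann algebra without minimal projections and $\tau:M\to\mathbb C$ is a faithful normal tracial state; put $\|x\|_2=\tau(x^*x)^{1/2}$. Let $\mathcal U$ be a free ultrafilter on $\mathbb N$, and let $M^{\mathcal U}=\ell^\infty(\mathbb N,M)/\mathcal J$ be the tracial ultrapower, where $\mathcal J=\{(x_n)_n:\lim_{n\to\mathcal U}\|x_n\|_2=0\}$, with trace $\tau^{\mathcal U}((x_n)_n)=\lim_{n\to\mathcal U}\tau(x_n)$. A unitary $u$ in $M$ (respectively in $M^{\mathcal U}$) is called a Haar unitary if $\tau(u^n)=0$ (respectively $\tau^{\mathcal U}(u^n)=0$) for all integers $n\ge 1$; write $\mathcal H(M)$ and $\mathcal H(M^{\mathcal U})$ for the sets of Haar unitaries. Let $D\subseteq\mathcal H(M)$ be a subset that is dense in $\mathcal H(M)$ for the strong operator topology. Then for every $u\in\mathcal H(M^{\mathcal U})$ there is a sequence $(u_n)_{n\in\mathbb N}$ with $u_n\in D$ for all $n$ and $u=(u_n)_n$ in $M^{\mathcal U}$. -/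

import Mathlib

open Filter Topology
open scoped ComplexOrder InnerProductSpace BoundedContinuousFunction

noncomputable section

namespace TracialVN

/-- A faithful normal tracial state on a von Neumann algebra `M ⊆ B(H)`.  Positivity refers to the
usual order of operators on `H`.  Normality is ultraweak (σ-weak) continuity, i.e. `τ` lies in the
predual of `M`: it is a sum of vector functionals with square-summable vectors. -/
structure FaithfulNormalTrace {H : Type*} [NormedAddCommGroup H] [InnerProductSpace ℂ H]
    [CompleteSpace H] (M : VonNeumannAlgebra H) where
  /-- the underlying linear functional -/
  toLin : M.toStarSubalgebra →ₗ[ℂ] ℂ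
  pos : ∀ x : M.toStarSubalgebra, 0 ≤ (x : H →L[ℂ] H) → 0 ≤ toLin x
  map_one : toLin 1 = 1
  tracial : ∀ x y : M.toStarSubalgebra, toLin (x * y) = toLin (y * x)
  faithful : ∀ x : M.toStarSubalgebra, toLin (star x * x) = 0 → x = 0
  normal : ∃ ξ η : ℕ → H, Summable (fun n => ‖ξ n‖ ^ 2) ∧ Summable (fun n => ‖η n‖ ^ 2) ∧
    ∀ x : M.toStarSubalgebra, HasSum (fun n => ⟪ξ n, (x : H →L[ℂ] H) (η n)⟫_ℂ) (toLin x)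

/-- `M` is diffuse: it has no minimal projection, i.e. every nonzero projection of `M` majorizes
a projection of `M` that is neither zero nor the whole of it. -/
def IsDiffuse {H : Type*} [NormedAddCommGroup H] [InnerProductSpace ℂ H]
    [CompleteSpace H] (M : VonNeumannAlgebra H) : Prop :=
  ∀ p ∈ M, IsStarProjection p → p ≠ 0 →
    ∃ q ∈ M, IsStarProjection q ∧ q ≤ p ∧ q ≠ 0 ∧ q ≠ p

/-- `u` is a Haar unitary with respect to the functional `φ`: a unitary all of whose positive
powers have zero trace. -/
def IsHaarUnitary {A : Type*} [Ring A] [StarRing A] (φ : A → ℂ) (u : A) : Prop :=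
  u ∈ unitary A ∧ ∀ n : ℕ, 0 < n → φ (u ^ n) = 0

/-- The image of a subset of `M` in `B(H)` with the strong operator topology, that is, the topology
of pointwise convergence on `H`. -/
def toSOT {H : Type*} [NormedAddCommGroup H] [InnerProductSpace ℂ H]
    [CompleteSpace H] {M : VonNeumannAlgebra H} (S : Set M.toStarSubalgebra) : Set (H →Lₚₜ[ℂ] H) :=
  (fun x : M.toStarSubalgebra =>
    ContinuousLinearMap.toPointwiseConvergenceCLM ℂ (RingHom.id ℂ) H H (x : H →L[ℂ] H)) '' S

/-- `D` is a subset of `S` that is dense in `S` for the strong operator topology. -/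
def IsSOTDenseSubset {H : Type*} [NormedAddCommGroup H] [InnerProductSpace ℂ H]
    [CompleteSpace H] {M : VonNeumannAlgebra H} (D S : Set M.toStarSubalgebra) : Prop :=
  D ⊆ S ∧ toSOT S ⊆ closure (toSOT D)

namespace FaithfulNormalTrace

variable {H : Type*} [NormedAddCommGroup H] [InnerProductSpace ℂ H] [CompleteSpace H]
  {M : VonNeumannAlgebra H} (τ : FaithfulNormalTrace M)

/-- The set `ℋ(M)` of Haar unitaries of `(M, τ)`. -/
def haarUnitaries : Set M.toStarSubalgebra := {u | IsHaarUnitary τ.toLin u}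

/-- The 2-norm `‖x‖₂ = τ(x⋆x)^{1/2}`. -/
def norm2 (x : M.toStarSubalgebra) : ℝ := Real.sqrt (τ.toLin (star x * x)).re

theorem star_mul_self_nonneg (x : M.toStarSubalgebra) : 0 ≤ τ.toLin (star x * x) :=
  τ.pos _ (_root_.star_mul_self_nonneg (x : H →L[ℂ] H))

theorem re_nonneg (x : M.toStarSubalgebra) : 0 ≤ (τ.toLin (star x * x)).re :=
  (Complex.nonneg_iff.1 (τ.star_mul_self_nonneg x)).1

theorem norm2_sq (x : M.toStarSubalgebra) : τ.norm2 x ^ 2 = (τ.toLin (star x * x)).re :=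
  Real.sq_sqrt (τ.re_nonneg x)

theorem norm2_nonneg (x : M.toStarSubalgebra) : 0 ≤ τ.norm2 x := Real.sqrt_nonneg _

theorem norm2_star (x : M.toStarSubalgebra) : τ.norm2 (star x) = τ.norm2 x := by
  simp only [norm2, star_star]
  rw [τ.tracial]

theorem norm2_mul_le (a x : M.toStarSubalgebra) : τ.norm2 (a * x) ≤ ‖a‖ * τ.norm2 x := by
  have key : 0 ≤ τ.toLin ((((‖a‖ ^ 2 : ℝ) : ℂ)) • (star x * x) - star (a * x) * (a * x)) := by
    apply τ.pos
    have h1 : star (a : H →L[ℂ] H) * a ≤ algebraMap ℝ (H →L[ℂ] H) (‖a‖ ^ 2) := by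
      have := IsSelfAdjoint.le_algebraMap_norm_self (IsSelfAdjoint.star_mul_self (a : H →L[ℂ] H))
      rwa [CStarRing.norm_star_mul_self, ← sq] at this
    have h2 := star_left_conjugate_nonneg (sub_nonneg.2 h1) (x : H →L[ℂ] H)
    convert h2 using 1
    simp only [AddSubgroupClass.coe_sub, star_mul, StarMemClass.coe_star, MulMemClass.coe_mul,
      SetLike.val_smul, mul_sub, sub_mul, Algebra.algebraMap_eq_smul_one, mul_assoc]
    congr 1
    rw [smul_mul_assoc, mul_smul_comm, one_mul]
    exact Complex.coe_smul (‖a‖ ^ 2) (star (x : H →L[ℂ] H) * (x : H →L[ℂ] H))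
  have h := (Complex.nonneg_iff.1 key).1
  simp only [map_sub, map_smul, Complex.sub_re, smul_eq_mul, Complex.re_ofReal_mul] at h
  rw [← norm2_sq, ← norm2_sq] at h
  refine (sq_le_sq₀ (τ.norm2_nonneg _) ?_).1 (by nlinarith)
  exact (mul_nonneg (norm_nonneg _) (τ.norm2_nonneg x))

theorem norm2_add_sq_le (x y : M.toStarSubalgebra) :
    τ.norm2 (x + y) ^ 2 ≤ 2 * τ.norm2 x ^ 2 + 2 * τ.norm2 y ^ 2 := by
  have h := τ.re_nonneg (x - y)
  simp only [norm2_sq]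
  simp only [star_add, star_sub, add_mul, mul_add, sub_mul, mul_sub, map_add, map_sub,
    Complex.add_re, Complex.sub_re] at h ⊢
  linarith

theorem toLin_star (x : M.toStarSubalgebra) : τ.toLin (star x) = star (τ.toLin x) := by
  have h0 := (Complex.nonneg_iff.1 (τ.star_mul_self_nonneg x)).2
  have h1 := (Complex.nonneg_iff.1 (τ.star_mul_self_nonneg (x + 1))).2
  have h2 := (Complex.nonneg_iff.1 (τ.star_mul_self_nonneg (x + Complex.I • 1))).2
  simp only [star_add, star_one, star_smul, add_mul, mul_add, map_add, mul_one, one_mul, map_smul,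
    smul_mul_assoc, mul_smul_comm, τ.map_one] at h1 h2
  simp at h1 h2
  apply Complex.ext <;> simp <;> linarith

/-- The trace is dominated by the 2-norm. -/
theorem norm_toLin_le (x : M.toStarSubalgebra) : ‖τ.toLin x‖ ≤ τ.norm2 x := by
  have h := τ.re_nonneg (x - (τ.toLin x) • 1)
  simp only [star_sub, star_one, star_smul, sub_mul, mul_sub, map_sub, mul_one, one_mul, map_smul,
    smul_mul_assoc, mul_smul_comm, τ.map_one, τ.toLin_star] at h
  refine (sq_le_sq₀ (norm_nonneg _) (τ.norm2_nonneg x)).1 ?_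
  rw [norm2_sq, ← Complex.normSq_eq_norm_sq, Complex.normSq_apply]
  simp at h
  linarith

/-- `ℓ^∞(ℕ, M)`, the star algebra of (operator-norm) bounded sequences in `M`. -/
abbrev BddSeq (M : VonNeumannAlgebra H) : Type _ := ℕ →ᵇ M.toStarSubalgebra

theorem tendsto_norm2_iff {𝒰 : Filter ℕ} (x : ℕ → M.toStarSubalgebra) :
    Tendsto (fun n => τ.norm2 (x n)) 𝒰 (𝓝 0) ↔ Tendsto (fun n => τ.norm2 (x n) ^ 2) 𝒰 (𝓝 0) := by
  constructor
  · intro h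
    simpa using h.pow 2
  · intro h
    have := (Real.continuous_sqrt.tendsto 0).comp h
    simpa [Function.comp_def, Real.sqrt_sq (τ.norm2_nonneg _)] using this

/-- The ideal `𝒥` of the bounded sequences `(x_n)` with `lim_{n → 𝒰} ‖x_n‖₂ = 0`. -/
def nullIdeal (𝒰 : Ultrafilter ℕ) : Ideal (BddSeq M) where
  carrier := {x | Tendsto (fun n => τ.norm2 (x n)) 𝒰 (𝓝 0)}
  zero_mem' := by simp [norm2]
  add_mem' := by
    intro x y hx hy
    simp only [Set.mem_ofPred_eq] at hx hy ⊢
    rw [tendsto_norm2_iff] at hx hy ⊢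
    refine squeeze_zero (fun n => sq_nonneg _) (fun n => τ.norm2_add_sq_le (x n) (y n)) ?_
    simpa using (hx.const_mul 2).add (hy.const_mul 2)
  smul_mem' := by
    intro a x hx
    simp only [Set.mem_ofPred_eq] at hx ⊢
    refine squeeze_zero (fun n => τ.norm2_nonneg _) (g := fun n => ‖a‖ * τ.norm2 (x n)) ?_ ?_
    · intro n
      exact (τ.norm2_mul_le (a n) (x n)).trans
        (mul_le_mul_of_nonneg_right (a.norm_coe_le_norm n) (τ.norm2_nonneg _))
    · simpa using hx.const_mul ‖a‖

theorem mem_nullIdeal {𝒰 : Ultrafilter ℕ} {x : BddSeq M} :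
    x ∈ τ.nullIdeal 𝒰 ↔ Tendsto (fun n => τ.norm2 (x n)) 𝒰 (𝓝 0) := Iff.rfl

theorem star_mem_nullIdeal {𝒰 : Ultrafilter ℕ} {x : BddSeq M} (hx : x ∈ τ.nullIdeal 𝒰) :
    star x ∈ τ.nullIdeal 𝒰 := by
  rw [mem_nullIdeal] at hx ⊢
  simpa [norm2_star] using hx

instance nullIdeal_isTwoSided (𝒰 : Ultrafilter ℕ) : (τ.nullIdeal 𝒰).IsTwoSided where
  mul_mem_of_left := by
    intro x b hx
    have := τ.star_mem_nullIdeal ((τ.nullIdeal 𝒰).mul_mem_left (star b) (τ.star_mem_nullIdeal hx))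
    simpa using this

/-- The tracial ultrapower `M^𝒰 = ℓ^∞(ℕ, M) / 𝒥`. -/
abbrev Ultrapower (𝒰 : Ultrafilter ℕ) : Type _ := BddSeq M ⧸ τ.nullIdeal 𝒰

/-- The class `(x_n)_n ∈ M^𝒰` of a bounded sequence. -/
def ultraMk (𝒰 : Ultrafilter ℕ) : BddSeq M →+* τ.Ultrapower 𝒰 := Ideal.Quotient.mk (τ.nullIdeal 𝒰)

theorem ultraMk_surjective (𝒰 : Ultrafilter ℕ) : Function.Surjective (τ.ultraMk 𝒰) :=
  Ideal.Quotient.mk_surjective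

theorem ultraMk_eq_iff {𝒰 : Ultrafilter ℕ} {x y : BddSeq M} :
    τ.ultraMk 𝒰 x = τ.ultraMk 𝒰 y ↔ Tendsto (fun n => τ.norm2 (x n - y n)) 𝒰 (𝓝 0) :=
  Ideal.Quotient.mk_eq_mk_iff_sub_mem x y

/-- The involution of `M^𝒰`, induced by the termwise one: `(x_n)_n⋆ = (x_n⋆)_n`. -/
instance ultrapowerStar (𝒰 : Ultrafilter ℕ) : Star (τ.Ultrapower 𝒰) where
  star := Quotient.map' star (by
    intro x y hxy
    rw [Submodule.quotientRel_def] at hxy ⊢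
    rw [← star_sub]
    exact τ.star_mem_nullIdeal hxy)

theorem star_ultraMk (𝒰 : Ultrafilter ℕ) (x : BddSeq M) : star (τ.ultraMk 𝒰 x) = τ.ultraMk 𝒰 (star x) := rfl

instance ultrapowerStarRing (𝒰 : Ultrafilter ℕ) : StarRing (τ.Ultrapower 𝒰) where
  star_involutive := by
    intro x
    obtain ⟨x, rfl⟩ := τ.ultraMk_surjective 𝒰 x
    simp [star_ultraMk]
  star_mul := by
    intro x y
    obtain ⟨x, rfl⟩ := τ.ultraMk_surjective 𝒰 x
    obtain ⟨y, rfl⟩ := τ.ultraMk_surjective 𝒰 y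
    rw [← map_mul, star_ultraMk, star_ultraMk, star_ultraMk, ← map_mul]
    exact congrArg _ (star_mul x y)
  star_add := by
    intro x y
    obtain ⟨x, rfl⟩ := τ.ultraMk_surjective 𝒰 x
    obtain ⟨y, rfl⟩ := τ.ultraMk_surjective 𝒰 y
    rw [← map_add, star_ultraMk, star_ultraMk, star_ultraMk, ← map_add, star_add]

/-- A bounded sequence has a limit of traces along every ultrafilter. -/
theorem tendsto_limUnder (𝒰 : Ultrafilter ℕ) (x : BddSeq M) :
    Tendsto (fun n => τ.toLin (x n)) 𝒰 (𝓝 (limUnder (𝒰 : Filter ℕ) fun n => τ.toLin (x n))) := by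
  apply tendsto_nhds_limUnder
  have hb : ∀ n, τ.toLin (x n) ∈ Metric.closedBall (0 : ℂ) (‖x‖ * τ.norm2 1) := by
    intro n
    rw [mem_closedBall_zero_iff]
    refine (τ.norm_toLin_le _).trans ?_
    have := τ.norm2_mul_le (x n) 1
    rw [mul_one] at this
    exact this.trans (mul_le_mul_of_nonneg_right (x.norm_coe_le_norm n) (τ.norm2_nonneg _))
  obtain ⟨z, -, hz⟩ := (isCompact_closedBall (0 : ℂ) (‖x‖ * τ.norm2 1)).ultrafilter_le_nhds
    (𝒰.map fun n => τ.toLin (x n)) (le_principal_iff.2 (Filter.mem_map.2 (univ_mem' hb)))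
  exact ⟨z, hz⟩

/-- The trace `τ^𝒰((x_n)_n) = lim_{n → 𝒰} τ(x_n)` of the ultrapower. -/
def ultraTrace (𝒰 : Ultrafilter ℕ) : τ.Ultrapower 𝒰 → ℂ :=
  Quotient.lift (fun x : BddSeq M => limUnder (𝒰 : Filter ℕ) fun n => τ.toLin (x n)) (by
    intro x y hxy
    have hxy : Tendsto (fun n => τ.norm2 (x n - y n)) 𝒰 (𝓝 0) :=
      (Submodule.quotientRel_def _).1 hxy
    refine tendsto_nhds_unique (τ.tendsto_limUnder 𝒰 x) ?_
    have h0 : Tendsto (fun n => τ.toLin (x n - y n)) 𝒰 (𝓝 0) :=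
      squeeze_zero_norm (fun n => τ.norm_toLin_le _) hxy
    simpa using h0.add (τ.tendsto_limUnder 𝒰 y))

theorem tendsto_ultraTrace (𝒰 : Ultrafilter ℕ) (x : BddSeq M) :
    Tendsto (fun n => τ.toLin (x n)) 𝒰 (𝓝 (τ.ultraTrace 𝒰 (τ.ultraMk 𝒰 x))) :=
  τ.tendsto_limUnder 𝒰 x

end FaithfulNormalTrace

end TracialVN

end

noncomputable section

namespace TracialVN

/-! ### `M` as an ordered C*-algebra -/

section Algebra

variable {H : Type*} [NormedAddCommGroup H] [InnerProductSpace ℂ H] [CompleteSpace H]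

/-! Lift `u` to a bounded sequence `x`. The heart is `eventually_exists_haar_near`: for each `ε`,
for `𝒰`-almost every `n` there is a Haar unitary of `M` within `ε` of `x n` in 2-norm. Normality
turns strong density of `D` into 2-norm density (`exists_mem_norm2_sub_lt`), and choosing almost
optimal points of `D` for all `n` finishes the proof.

Morally, write `u = exp(2πih)` with `h` uniformly distributed on `[0, 1]`, lift `h` to self-adjoint
`a n`, and correct the distribution of each `a n`. Only the *-algebra structure and trace of the
ultrapower are used, so `h` is replaced by the self-conjugate part of a Laurent polynomial `p` in
`u`, where the trigonometric polynomial of `p` is close to the identity function on `(0, 1]`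
(`exists_trig_approx`). A Haar unitary has the moments of Lebesgue measure on the circle, so
Weierstrass approximation makes traces of continuous functions of `a n` converge to integrals
(`tendsto_toLin_mul_cfc`). Hence `a n` is almost uniformly distributed, and a step approximation of
`exp(2πi a n)` is close to `x n` (`tendsto_norm2_smoothStep_sub_sq`).

To correct the distribution inside `M`, extend the chain of spectral projections of `a n` to a
maximal chain. Since `M` is diffuse, the trace maps that chain onto `[0, 1]` (`exists_mem_flag`),
which gives projections `e t` of trace `t` comparable with the spectral ones. Comparable projections
with close traces are close in 2-norm, so the Haar unitary `∫ exp(2πit) de_t`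
(`exists_haar_of_flow`) is close to the step approximation (`exists_haar_near_smoothStep`). -/

theorem mem_of_forall_commute (M : VonNeumannAlgebra H) {x : H →L[ℂ] H}
    (h : ∀ y ∈ M.commutant, Commute x y) : x ∈ M := by
  rw [← M.commutant_commutant, VonNeumannAlgebra.mem_commutant_iff]
  exact fun y hy => (h y hy).eq.symm

theorem commute_of_mem_commutant {M : VonNeumannAlgebra H} {x y : H →L[ℂ] H} (hx : x ∈ M)
    (hy : y ∈ M.commutant) : Commute x y :=
  VonNeumannAlgebra.mem_commutant_iff.1 hy x hx

theorem isClosed_vonNeumannAlgebra (M : VonNeumannAlgebra H) :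
    IsClosed (M.toStarSubalgebra : Set (H →L[ℂ] H)) := by
  have h : IsClosed (M : Set (H →L[ℂ] H)) := by
    rw [← M.centralizer_centralizer]
    exact Set.isClosed_centralizer _
  exact h

instance instCStarAlgebra (M : VonNeumannAlgebra H) : CStarAlgebra M.toStarSubalgebra where
  toCompleteSpace := (isClosed_vonNeumannAlgebra M).completeSpace_coe

/-- The square root of a positive element of `M` commutes with the commutant, so it lies in `M` by
the bicommutant property. Thus positivity in `B(H)` and in `M` agree, and the functional calculus of
`M` respects the operator order. -/
instance instStarOrderedRing (M : VonNeumannAlgebra H) : StarOrderedRing M.toStarSubalgebra := by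
  refine StarOrderedRing.of_nonneg_iff' (fun {x y} hxy z => ?_) (fun x => ⟨fun hx => ?_, ?_⟩)
  · exact add_le_add_right (α := H →L[ℂ] H) hxy z
  · have hx' : 0 ≤ (x : H →L[ℂ] H) := hx
    have hm : CFC.sqrt (x : H →L[ℂ] H) ∈ M := by
      refine mem_of_forall_commute M fun y hy => ?_
      have := (commute_of_mem_commutant x.2 hy).cfcₙ_nnreal NNReal.sqrt
      exact this
    refine ⟨⟨CFC.sqrt (x : H →L[ℂ] H), hm⟩, Subtype.ext ?_⟩
    have h2 : star (CFC.sqrt (x : H →L[ℂ] H)) = CFC.sqrt (x : H →L[ℂ] H) :=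
      (CFC.sqrt_nonneg (x : H →L[ℂ] H)).isSelfAdjoint
    change _ = star (CFC.sqrt (x : H →L[ℂ] H)) * _
    rw [h2, CFC.sqrt_mul_sqrt_self _ hx']
  · rintro ⟨s, rfl⟩
    exact _root_.star_mul_self_nonneg (s : H →L[ℂ] H)

end Algebra

/-! ### The 2-norm and the trace on projections -/

namespace FaithfulNormalTrace

variable {H : Type*} [NormedAddCommGroup H] [InnerProductSpace ℂ H] [CompleteSpace H]
  {M : VonNeumannAlgebra H} (τ : FaithfulNormalTrace M)

/-- The pre-inner product `⟪x, y⟫ = τ(x⋆ y)`. -/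
@[reducible]
def preInnerCore : PreInnerProductSpace.Core ℂ M.toStarSubalgebra where
  inner x y := τ.toLin (star x * y)
  conj_inner_symm x y := by
    rw [starRingEnd_apply, ← τ.toLin_star, star_mul, star_star]
  re_inner_nonneg x := τ.re_nonneg x
  add_left x y z := by simp [add_mul]
  smul_left x y r := by simp

theorem norm2_add_le (x y : M.toStarSubalgebra) : τ.norm2 (x + y) ≤ τ.norm2 x + τ.norm2 y :=
  @norm_add_le _ (@InnerProductSpace.Core.toSeminormedAddCommGroup ℂ _ _ _ _
    τ.preInnerCore).toSeminormedAddGroup x y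

theorem norm2_smul (c : ℂ) (x : M.toStarSubalgebra) : τ.norm2 (c • x) = ‖c‖ * τ.norm2 x := by
  refine (sq_eq_sq₀ (τ.norm2_nonneg _) (mul_nonneg (norm_nonneg _) (τ.norm2_nonneg _))).1 ?_
  rw [mul_pow, norm2_sq, norm2_sq, star_smul, smul_mul_smul_comm, map_smul]
  simp only [Complex.star_def, smul_eq_mul, ← Complex.normSq_eq_conj_mul_self,
    Complex.re_ofReal_mul, Complex.normSq_eq_norm_sq]

theorem norm2_sub_comm (x y : M.toStarSubalgebra) : τ.norm2 (x - y) = τ.norm2 (y - x) := by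
  rw [← neg_sub, ← neg_one_smul ℂ, norm2_smul]
  simp

theorem norm2_sub_le (x y z : M.toStarSubalgebra) :
    τ.norm2 (x - z) ≤ τ.norm2 (x - y) + τ.norm2 (y - z) := by
  have := τ.norm2_add_le (x - y) (y - z)
  rwa [sub_add_sub_cancel] at this

theorem norm2_sum_le {ι : Type*} (s : Finset ι) (f : ι → M.toStarSubalgebra) :
    τ.norm2 (∑ i ∈ s, f i) ≤ ∑ i ∈ s, τ.norm2 (f i) :=
  Finset.le_sum_of_subadditive _ (by simp [norm2]) τ.norm2_add_le _ _

theorem norm2_one : τ.norm2 1 = 1 := by simp [norm2, τ.map_one]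

theorem norm2_le_norm (x : M.toStarSubalgebra) : τ.norm2 x ≤ ‖x‖ := by
  simpa [norm2_one] using τ.norm2_mul_le x 1

theorem norm_toLin_le_norm (x : M.toStarSubalgebra) : ‖τ.toLin x‖ ≤ ‖x‖ :=
  (τ.norm_toLin_le x).trans (τ.norm2_le_norm x)

theorem continuous_toLin : Continuous τ.toLin :=
  (τ.toLin.mkContinuous 1 fun x => by simpa using τ.norm_toLin_le_norm x).continuous

theorem re_toLin_mono {x y : M.toStarSubalgebra} (h : x ≤ y) :
    (τ.toLin x).re ≤ (τ.toLin y).re := by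
  have := (Complex.nonneg_iff.1 (τ.pos (y - x) (sub_nonneg.2 h))).1
  simpa using this

/-- The trace of a self-adjoint element is real. -/
theorem toLin_eq_re {x : M.toStarSubalgebra} (hx : IsSelfAdjoint x) :
    τ.toLin x = ((τ.toLin x).re : ℂ) := by
  have := τ.toLin_star x
  rw [hx.star_eq] at this
  exact (Complex.conj_eq_iff_re.1 this.symm).symm

theorem norm2_sq_of_isStarProjection {p : M.toStarSubalgebra} (hp : IsStarProjection p) :
    τ.norm2 p ^ 2 = (τ.toLin p).re := by
  rw [norm2_sq, hp.isSelfAdjoint.star_eq, hp.isIdempotentElem.eq]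

theorem eq_zero_of_re_toLin_eq_zero {p : M.toStarSubalgebra} (hp : IsStarProjection p)
    (h : (τ.toLin p).re = 0) : p = 0 := by
  apply τ.faithful
  rw [hp.isSelfAdjoint.star_eq, hp.isIdempotentElem.eq, τ.toLin_eq_re hp.isSelfAdjoint, h]
  simp

/-- Comparable projections are as close in 2-norm as their traces are. -/
theorem norm2_sub_sq_of_le_or_le {p q : M.toStarSubalgebra} (hp : IsStarProjection p)
    (hq : IsStarProjection q) (h : p ≤ q ∨ q ≤ p) :
    τ.norm2 (p - q) ^ 2 = |(τ.toLin p).re - (τ.toLin q).re| := by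
  wlog hqp : q ≤ p generalizing p q
  · rw [norm2_sub_comm, abs_sub_comm]
    exact this hq hp h.symm (h.resolve_right hqp)
  rw [norm2_sq_of_isStarProjection τ ((hq.le_iff_sub hp).1 hqp), map_sub, Complex.sub_re,
    abs_of_nonneg (sub_nonneg.2 (τ.re_toLin_mono hqp))]

end FaithfulNormalTrace


/-! ### The ordered set of projections of `M` -/

section Projections

variable {H : Type*} [NormedAddCommGroup H] [InnerProductSpace ℂ H] [CompleteSpace H]

/-- The projections of a von Neumann algebra, with the order of operators. -/
abbrev Proj (M : VonNeumannAlgebra H) : Type _ := {p : M.toStarSubalgebra // IsStarProjection p}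

variable {M : VonNeumannAlgebra H}

/-- A projection onto a closed subspace that is invariant under the commutant, as an element of
the von Neumann algebra. -/
def projOfInvariant (K : Submodule ℂ H) [K.HasOrthogonalProjection]
    (hK : ∀ y ∈ M.commutant, ∀ x ∈ K, y x ∈ K) : Proj M :=
  ⟨⟨K.starProjection, (VonNeumannAlgebra.IsStarProjection.mem_iff
    isStarProjection_starProjection M).2 fun y hy => by
      rw [Module.End.mem_invtSubmodule]
      intro x hx
      have hr : K.starProjection.range = K := Submodule.range_starProjection K
      rw [hr] at hx
      simp only [Submodule.mem_comap, hr]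
      exact hK y hy x hx⟩,
    by
      have := isStarProjection_starProjection (𝕜 := ℂ) (U := K)
      exact ⟨Subtype.ext this.isIdempotentElem.eq, Subtype.ext this.isSelfAdjoint.star_eq⟩⟩

theorem Proj.le_iff {p q : Proj M} :
    p ≤ q ↔ ∀ x, (q : M.toStarSubalgebra).1 ((p : M.toStarSubalgebra).1 x) = (p : M.toStarSubalgebra).1 x := by
  rw [← Subtype.coe_le_coe, p.2.le_iff_mul_eq_right q.2, Subtype.ext_iff, ContinuousLinearMap.ext_iff]
  rfl

/-- The complementary projection. -/
def Proj.compl (p : Proj M) : Proj M := ⟨1 - p.1, p.2.one_sub⟩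

theorem Proj.compl_compl (p : Proj M) : p.compl.compl = p :=
  Subtype.ext (sub_sub_cancel _ _)

theorem Proj.compl_le_compl {p q : Proj M} : p.compl ≤ q.compl ↔ q ≤ p :=
  sub_le_sub_iff_left (a := (1 : M.toStarSubalgebra))

/-- Diffuseness splits the nonzero projection `q - p`; adding a proper nonzero part `r` of it to `p`
gives the intermediate projection. -/
theorem IsDiffuse.exists_between (hM : IsDiffuse M) {p q : Proj M} (h : p < q) :
    ∃ r : Proj M, p < r ∧ r < q := by
  obtain ⟨p, hp⟩ := p
  obtain ⟨q, hq⟩ := q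
  have hle : p ≤ q := h.le
  have hd := (hp.le_iff_sub hq).1 hle
  have hne : q - p ≠ 0 := fun h0 => h.ne (Subtype.ext (sub_eq_zero.1 h0).symm)
  obtain ⟨r, hrM, hr, hrle, hr0, hrne⟩ := hM (q - p : M.toStarSubalgebra).1 (q - p).2
    ⟨congrArg Subtype.val hd.isIdempotentElem.eq, congrArg Subtype.val hd.isSelfAdjoint.star_eq⟩
    (fun h0 => hne (Subtype.ext h0))
  let r' : M.toStarSubalgebra := ⟨r, hrM⟩
  have hr' : IsStarProjection r' :=
    ⟨Subtype.ext hr.isIdempotentElem.eq, Subtype.ext hr.isSelfAdjoint.star_eq⟩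
  have hrle' : r' ≤ q - p := hrle
  have hd2 := (hr'.le_iff_sub hd).1 hrle'
  have hs : IsStarProjection (p + r') := by
    have : p + r' = q - ((q - p) - r') := by abel
    rw [this]
    refine (hd2.le_iff_sub hq).1 ?_
    have h1 : (q - p) - r' ≤ q - p := sub_le_self _ hr'.nonneg
    exact h1.trans (sub_le_self _ hp.nonneg)
  refine ⟨⟨p + r', hs⟩, lt_of_le_of_ne ?_ ?_, lt_of_le_of_ne ?_ ?_⟩
  · exact le_add_of_nonneg_right (a := p) hr'.nonneg
  · intro he
    have : p = p + r' := congrArg Subtype.val he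
    exact hr0 (congrArg Subtype.val (left_eq_add.1 this))
  · have := add_le_add_right hrle' p
    rwa [add_sub_cancel] at this
  · intro he
    have : p + r' = q := congrArg Subtype.val he
    exact hrne (congrArg Subtype.val (eq_sub_of_add_eq' this))

end Projections

/-! ### Normality, and maximal chains of projections -/

namespace FaithfulNormalTrace

variable {H : Type*} [NormedAddCommGroup H] [InnerProductSpace ℂ H] [CompleteSpace H]
  {M : VonNeumannAlgebra H} (τ : FaithfulNormalTrace M)

/-- A net of contractions converging pointwise has convergent traces. -/
theorem tendsto_toLin_of_tendsto_apply {ι : Type*} {l : Filter ι} {x : ι → M.toStarSubalgebra}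
    {y : M.toStarSubalgebra} (hx : ∀ i, ‖x i‖ ≤ 1)
    (h : ∀ v, Tendsto (fun i => (x i).1 v) l (𝓝 (y.1 v))) :
    Tendsto (fun i => τ.toLin (x i)) l (𝓝 (τ.toLin y)) := by
  obtain ⟨ξ, η, hξ, hη, hs⟩ := τ.normal
  simp_rw [← fun i => (hs (x i)).tsum_eq, ← (hs y).tsum_eq]
  -- Contractivity gives the summable majorant `‖ξ n‖‖η n‖ ≤ ‖ξ n‖² + ‖η n‖²`, uniformly along the
  -- net.
  refine tendsto_tsum_of_dominated_convergence (hξ.add hη)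
    (fun n => (tendsto_const_nhds.inner (h (η n)))) (.of_forall fun i n => ?_)
  have h1 : ‖(x i).1 (η n)‖ ≤ ‖η n‖ := by
    simpa using ((x i).1.le_opNorm (η n)).trans
      (mul_le_mul_of_nonneg_right (hx i) (norm_nonneg _))
  refine (norm_inner_le_norm _ _).trans ?_
  nlinarith [norm_nonneg (ξ n), norm_nonneg (η n), sq_nonneg (‖ξ n‖ - ‖η n‖),
    mul_le_mul_of_nonneg_left h1 (norm_nonneg (ξ n))]

/-- The supremum projects onto the closed span of the ranges, which the commutant leaves invariant.
A chain is directed, so its projections converge strongly to this one, and normality carries bounds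
on the trace to the limit. -/
theorem exists_isLUB_of_isChain {S : Set (Proj M)} (hS : IsChain (· ≤ ·) S) (hne : S.Nonempty) :
    ∃ p : Proj M, IsLUB S p ∧ ∀ t : ℝ, (∀ e ∈ S, (τ.toLin e.1).re ≤ t) → (τ.toLin p.1).re ≤ t := by
  let U : S → Submodule ℂ H := fun e => (e.1.1.1 : H →L[ℂ] H).range
  have hstar : ∀ e : S, IsStarProjection (e.1.1.1 : H →L[ℂ] H) := fun e =>
    ⟨congrArg Subtype.val e.1.2.isIdempotentElem.eq, congrArg Subtype.val e.1.2.isSelfAdjoint.star_eq⟩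
  have _ : ∀ e, (U e).HasOrthogonalProjection := fun e =>
    (isStarProjection_iff_eq_starProjection_range.1 (hstar e)).choose
  have hproj : ∀ e : S, (U e).starProjection = (e.1.1.1 : H →L[ℂ] H) := fun e =>
    (isStarProjection_iff_eq_starProjection_range.1 (hstar e)).choose_spec.symm
  let K : Submodule ℂ H := (⨆ i, U i).topologicalClosure
  have hK : ∀ y ∈ M.commutant, ∀ x ∈ K, y x ∈ K := by
    intro y hy
    suffices K ≤ K.comap (y : H →ₗ[ℂ] H) from this
    refine Submodule.topologicalClosure_minimal _ (iSup_le fun e => ?_)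
      ((Submodule.isClosed_topologicalClosure _).preimage y.continuous)
    rintro _ ⟨x, rfl⟩
    refine Submodule.le_topologicalClosure _ (le_iSup U e ?_)
    refine ⟨y x, ?_⟩
    exact DFunLike.congr_fun (commute_of_mem_commutant e.1.1.2 hy).eq x
  have hmono : Monotone U := by
    rintro e f hef _ ⟨x, rfl⟩
    exact ⟨_, Proj.le_iff.1 hef x⟩
  refine ⟨projOfInvariant K hK, ⟨fun e he => ?_, fun f hf => ?_⟩, fun t ht => ?_⟩
  · refine Proj.le_iff.2 fun x => ?_
    refine Submodule.starProjection_eq_self_iff.2 ?_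
    exact Submodule.le_topologicalClosure _ (le_iSup U ⟨e, he⟩ ⟨x, rfl⟩)
  · refine Proj.le_iff.2 fun x => ?_
    suffices K ≤ ((f.1.1 : H →L[ℂ] H) - 1).ker by
      exact sub_eq_zero.1 (this (Submodule.starProjection_apply_mem K x))
    refine Submodule.topologicalClosure_minimal _ (iSup_le fun e => ?_)
      (ContinuousLinearMap.isClosed_ker _)
    rintro _ ⟨x, rfl⟩
    exact sub_eq_zero.2 (Proj.le_iff.1 (hf e.2) x)
  · have : Nonempty S := hne.to_subtype
    have : IsDirectedOrder S := ⟨fun e f => (hS.total e.2 f.2).elim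
      (fun h => ⟨f, h, le_rfl⟩) fun h => ⟨e, le_rfl, h⟩⟩
    have := τ.tendsto_toLin_of_tendsto_apply (l := atTop) (x := fun e : S => e.1.1)
      (y := (projOfInvariant K hK).1) (fun e => e.1.2.norm_le) (fun v => by
        have := Submodule.starProjection_tendsto_closure_iSup U hmono v
        simp only [hproj] at this; exact this)
    exact le_of_tendsto ((Complex.continuous_re.tendsto _).comp this) (.of_forall fun e => ht _ e.2)

theorem exists_isGLB_of_isChain {S : Set (Proj M)} (hS : IsChain (· ≤ ·) S) (hne : S.Nonempty) :
    ∃ p : Proj M, IsGLB S p ∧ ∀ t : ℝ, (∀ e ∈ S, t ≤ (τ.toLin e.1).re) → t ≤ (τ.toLin p.1).re := by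
  obtain ⟨p, ⟨hp1, hp2⟩, hp⟩ := τ.exists_isLUB_of_isChain (S := Proj.compl '' S) (by
      rintro _ ⟨e, he, rfl⟩ _ ⟨f, hf, rfl⟩ hne
      exact ((hS.total he hf).imp Proj.compl_le_compl.2 Proj.compl_le_compl.2).symm) (hne.image _)
  refine ⟨p.compl, ⟨fun e he => ?_, fun f hf => ?_⟩, fun t ht => ?_⟩
  · rw [← e.compl_compl, Proj.compl_le_compl]
    exact hp1 ⟨e, he, rfl⟩
  · rw [← f.compl_compl, Proj.compl_le_compl]
    refine hp2 ?_
    rintro _ ⟨e, he, rfl⟩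
    exact Proj.compl_le_compl.2 (hf he)
  · have := hp (1 - t) (by
      rintro _ ⟨e, he, rfl⟩
      have := ht e he
      simp only [Proj.compl, map_sub, τ.map_one, Complex.sub_re, Complex.one_re]
      linarith)
    simp only [Proj.compl, map_sub, τ.map_one, Complex.sub_re, Complex.one_re]
    linarith

/-- In a diffuse von Neumann algebra the trace maps every maximal chain of projections onto
`[0, 1]`. -/
theorem exists_mem_flag (hM : IsDiffuse M) (C : Flag (Proj M)) {t : ℝ} (h0 : 0 ≤ t) (h1 : t ≤ 1) :
    ∃ e ∈ C, (τ.toLin e.1).re = t := by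
  have hz : (⟨0, .zero _⟩ : Proj M) ∈ C := Flag.mem_iff_forall_le_or_ge.2 fun b _ => .inl b.2.nonneg
  have ho : (⟨1, .one _⟩ : Proj M) ∈ C := Flag.mem_iff_forall_le_or_ge.2 fun b _ => .inr b.2.le_one
  obtain ⟨p, ⟨hp1, hp2⟩, hp⟩ := τ.exists_isLUB_of_isChain
    (S := {e | e ∈ C ∧ (τ.toLin e.1).re ≤ t}) (C.chain_le.mono fun e he => he.1) ⟨_, hz, by simpa⟩
  obtain ⟨q, ⟨hq1, hq2⟩, hq⟩ := τ.exists_isGLB_of_isChain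
    (S := {e | e ∈ C ∧ t ≤ (τ.toLin e.1).re}) (C.chain_le.mono fun e he => he.1)
    ⟨_, ho, by simpa [τ.map_one]⟩
  have hpt := hp t fun e he => he.2
  have hqt := hq t fun e he => he.2
  have key : ∀ b ∈ C, b ≤ p ∨ q ≤ b := fun b hb =>
    (le_total (τ.toLin b.1).re t).imp (fun h => hp1 ⟨hb, h⟩) fun h => hq1 ⟨hb, h⟩
  -- If the order were reversed, `b ≤ e` with `τ e ≤ t ≤ τ b` would force equal traces, and
  -- faithfulness gives `e = b`.
  have hpC' : ∀ b ∈ C, t ≤ (τ.toLin b.1).re → p ≤ b := fun b hb hbt => hp2 fun e he => by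
    rcases C.le_or_le he.1 hb with h | h
    · exact h
    · have h2 := τ.re_toLin_mono (show b.1 ≤ e.1 from h)
      rw [show e = b from ?_]
      have h3 : (e.1 - b.1) = 0 := τ.eq_zero_of_re_toLin_eq_zero ((b.2.le_iff_sub e.2).1 h) (by
        have := he.2
        simp only [map_sub, Complex.sub_re]
        linarith)
      exact Subtype.ext (sub_eq_zero.1 h3)
  have hpq : p ≤ q := hq2 fun e he => hpC' e he.1 he.2
  -- By maximality nothing between `p` and `q` is missing from `C`. By `key`, no element of `C` lies
  -- strictly between them, so a strict gap contradicts diffuseness.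
  have hmem : ∀ r, p ≤ r → r ≤ q → r ∈ C := fun r hr hr' =>
    Flag.mem_iff_forall_le_or_ge.2 fun b hb =>
      (key b hb).symm.imp hr'.trans fun h => h.trans hr
  rcases hpq.eq_or_lt with h | h
  · exact ⟨p, hmem p le_rfl hpq, le_antisymm hpt (h ▸ hqt)⟩
  · obtain ⟨r, hr1, hr2⟩ := hM.exists_between h
    rcases key r (hmem r hr1.le hr2.le) with h3 | h3
    · exact absurd h3 hr1.not_ge
    · exact absurd h3 hr2.not_ge

/-- A chain of projections can be matched with a monotone family of projections in which the
trace of the projection of index `t` is `t`. -/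
theorem exists_flow (hM : IsDiffuse M) {S : Set (Proj M)} (hS : IsChain (· ≤ ·) S) :
    ∃ e : ℝ → Proj M, (∀ t ∈ Set.Icc (0 : ℝ) 1, τ.toLin (e t).1 = t) ∧
      Monotone e ∧ ∀ t, ∀ p ∈ S, p ≤ e t ∨ e t ≤ p := by
  obtain ⟨C, hC⟩ := hS.exists_subset_flag
  choose e he using fun t : Set.Icc (0 : ℝ) 1 => τ.exists_mem_flag hM C t.2.1 t.2.2
  have hmono : Monotone e := by
    intro s t hst
    rcases C.le_or_le (he s).1 (he t).1 with h | h
    · exact h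
    · have h3 : ((e s).1 - (e t).1) = 0 :=
        τ.eq_zero_of_re_toLin_eq_zero (((e t).2.le_iff_sub (e s).2).1 h) (le_antisymm (by
          simpa [(he s).2, (he t).2] using hst) (by
          simpa using τ.re_toLin_mono (show (e t).1 ≤ (e s).1 from h)))
      exact (Subtype.ext (sub_eq_zero.1 h3)).le
  -- Outside `[0, 1]` the family is constant, so that it is monotone on all of `ℝ`.
  refine ⟨fun t => e (Set.projIcc 0 1 zero_le_one t), fun t ht => ?_,
    hmono.comp (Set.monotone_projIcc _), fun t p hp => C.le_or_le (hC hp) (he _).1⟩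
  rw [τ.toLin_eq_re (e _).2.isSelfAdjoint, (he _).2, Set.projIcc_of_mem _ ht]

end FaithfulNormalTrace


/-! ### Step elements and the Haar unitary of a flow of projections -/

section StepElements

variable {A : Type*} [CStarAlgebra A] {ι : Type*} [Fintype ι]

/-- The star homomorphism `f ↦ ∑ f i • q i` given by a partition of unity into projections. -/
def partitionHom (q : ι → A) (hq : ∀ i, IsStarProjection (q i))
    (horth : ∀ i j, i ≠ j → q i * q j = 0) (hsum : ∑ i, q i = 1) : (ι → ℂ) →⋆ₐ[ℂ] A where
  toFun f := ∑ i, f i • q i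
  map_one' := by simp [hsum]
  map_zero' := by simp
  map_add' f g := by simp [add_smul, Finset.sum_add_distrib]
  map_mul' f g := by
    rw [Finset.sum_mul_sum]
    refine Finset.sum_congr rfl fun i _ => ?_
    rw [Finset.sum_eq_single i]
    · rw [smul_mul_smul_comm, (hq i).isIdempotentElem.eq, Pi.mul_apply]
    · intro j _ hj
      rw [smul_mul_smul_comm, horth i j hj.symm, smul_zero]
    · simp
  commutes' c := by
    simp [Algebra.algebraMap_eq_smul_one, ← hsum, Finset.smul_sum]
  map_star' f := by
    simp [(hq _).isSelfAdjoint.star_eq]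

theorem partitionHom_apply (q : ι → A) (hq : ∀ i, IsStarProjection (q i))
    (horth : ∀ i j, i ≠ j → q i * q j = 0) (hsum : ∑ i, q i = 1) (f : ι → ℂ) :
    partitionHom q hq horth hsum f = ∑ i, f i • q i := rfl

end StepElements

theorem sum_range_two_mul {A : Type*} [AddCommMonoid A] (g : ℕ → A) (N : ℕ) :
    ∑ j ∈ Finset.range (2 * N), g j = ∑ j ∈ Finset.range N, (g (2 * j) + g (2 * j + 1)) := by
  induction N with
  | zero => simp
  | succ n ih => rw [mul_add, mul_one, Finset.sum_range_succ, Finset.sum_range_succ, ih,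
      Finset.sum_range_succ, add_assoc]

/-- The point `exp(2πit)` of the unit circle. -/
def circlePt (t : ℝ) : ℂ := Complex.exp (Complex.I * (2 * Real.pi * t : ℝ))

theorem circlePt_add (s t : ℝ) : circlePt (s + t) = circlePt s * circlePt t := by
  rw [circlePt, circlePt, circlePt, ← Complex.exp_add]
  congr 1
  push_cast
  ring

theorem norm_circlePt (t : ℝ) : ‖circlePt t‖ = 1 := by
  rw [circlePt, mul_comm, Complex.norm_exp_ofReal_mul_I]

theorem star_circlePt_mul_self (t : ℝ) : star (circlePt t) * circlePt t = 1 := by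
  rw [Complex.star_def, Complex.conj_mul', norm_circlePt]
  simp

theorem circlePt_pow (t : ℝ) (n : ℕ) : circlePt t ^ n = circlePt (n * t) := by
  rw [circlePt, circlePt, ← Complex.exp_nat_mul]
  congr 1
  push_cast
  ring

theorem norm_circlePt_sub_le (s t : ℝ) :
    ‖circlePt s - circlePt t‖ ≤ 2 * Real.pi * |s - t| := by
  have h : circlePt s = circlePt (s - t) * circlePt t := by rw [← circlePt_add, sub_add_cancel]
  have h2 := Real.norm_exp_I_mul_ofReal_sub_one_le (x := 2 * Real.pi * (s - t))
  rw [h, ← sub_one_mul, norm_mul, norm_circlePt, mul_one]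
  refine h2.trans ?_
  rw [norm_mul, Real.norm_eq_abs, abs_of_pos (by positivity), Real.norm_eq_abs]

theorem circlePt_eq_one_iff (t : ℝ) : circlePt t = 1 ↔ ∃ n : ℤ, t = n := by
  rw [circlePt, Complex.exp_eq_one_iff]
  refine exists_congr fun n => ?_
  constructor
  · intro h
    have h1 : (t : ℂ) * (2 * Real.pi * Complex.I) = n * (2 * Real.pi * Complex.I) := by
      rw [← h]; push_cast; ring
    exact_mod_cast mul_right_cancel₀ Complex.two_pi_I_ne_zero h1
  · rintro rfl
    push_cast
    ring

/-- A geometric sum with ratio `exp(2πik/N)`, an `N`-th root of unity that differs from `1` because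
`0 < k < N`. -/
theorem sum_circlePt_pow_eq_zero {k N : ℕ} (hk : 0 < k) (hkN : k < N) :
    ∑ j ∈ Finset.range N, circlePt (j / N) ^ k = 0 := by
  have hN : (N : ℝ) ≠ 0 := by exact_mod_cast (hk.trans hkN).ne'
  have h1 : circlePt (k / N) ≠ 1 := by
    rw [Ne, circlePt_eq_one_iff]
    rintro ⟨n, hn⟩
    rw [div_eq_iff hN] at hn
    have h2 : (k : ℤ) = n * N := by exact_mod_cast hn
    have h3 : 0 < n := by
      by_contra! h
      nlinarith
    nlinarith
  have h2 : circlePt (k / N) ^ N = 1 := by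
    rw [circlePt_pow, circlePt_eq_one_iff]
    exact ⟨k, by field_simp; simp⟩
  have h3 : ∀ j : ℕ, circlePt (j / N) ^ k = circlePt (k / N) ^ j := fun j => by
    rw [circlePt_pow, circlePt_pow]
    congr 1
    ring
  simp_rw [h3]
  have := mul_geom_sum (circlePt (k / N)) N
  rw [h2, sub_self] at this
  exact (mul_eq_zero.1 this).resolve_left (sub_ne_zero.2 h1)

namespace FaithfulNormalTrace

variable {H : Type*} [NormedAddCommGroup H] [InnerProductSpace ℂ H] [CompleteSpace H]
  {M : VonNeumannAlgebra H} (τ : FaithfulNormalTrace M)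

/-- The step element `∑_{j<N} f j • (e((j+1)/N) - e(j/N))`. -/
def stepElement (e : ℝ → Proj M) (N : ℕ) (f : ℕ → ℂ) : M.toStarSubalgebra :=
  ∑ j ∈ Finset.range N, f j • ((e ((j + 1 : ℕ) / N)).1 - (e ((j : ℕ) / N)).1)

/-- The increments of a monotone family are orthogonal projections with sum `1`. Unitarity, powers
and norm bounds for step elements can then be read off in `ℂ^N`. -/
theorem exists_stepHom {e : ℝ → Proj M} (he : Monotone e) (h0 : (e 0).1 = 0) (h1 : (e 1).1 = 1)
    {N : ℕ} (hN : 0 < N) :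
    ∃ φ : (Fin N → ℂ) →⋆ₐ[ℂ] M.toStarSubalgebra, ∀ f : ℕ → ℂ,
      φ (fun j => f j) = stepElement e N f := by
  have hN' : (N : ℝ) ≠ 0 := by exact_mod_cast hN.ne'
  have hc : Monotone fun j : ℕ => e (j / N) := fun i j hij => he (by gcongr)
  have hmul : ∀ i j : ℕ, i ≤ j → (e (i / N)).1 * (e (j / N)).1 = (e (i / N)).1 := fun i j hij =>
    ((e _).2.le_iff_mul_eq_left (e _).2).1 (hc hij)
  have hmul' : ∀ i j : ℕ, i ≤ j → (e (j / N)).1 * (e (i / N)).1 = (e (i / N)).1 := fun i j hij =>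
    ((e _).2.le_iff_mul_eq_right (e _).2).1 (hc hij)
  refine ⟨partitionHom (fun j : Fin N => (e ((j + 1 : ℕ) / N)).1 - (e ((j : ℕ) / N)).1)
    (fun j => ((e _).2.le_iff_sub (e _).2).1 (hc (Nat.le_succ j))) (fun i j hij => ?_) ?_,
    fun f => ?_⟩
  · rcases lt_or_gt_of_ne (Fin.val_injective.ne hij) with h | h
    · simp only [sub_mul, mul_sub, hmul i j h.le, hmul i (j + 1) (by lia),
        hmul (i + 1) j (by lia), hmul (i + 1) (j + 1) (by lia), sub_self]
    · simp only [sub_mul, mul_sub, hmul' j i h.le, hmul' j (i + 1) (by lia),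
        hmul' (j + 1) i (by lia), hmul' (j + 1) (i + 1) (by lia), sub_self]
  · rw [Fin.sum_univ_eq_sum_range (fun j => (e ((j + 1 : ℕ) / N)).1 - (e ((j : ℕ) / N)).1),
      Finset.sum_range_sub (fun j : ℕ => (e (j / N)).1), div_self hN', h1]
    simp [h0]
  · rw [partitionHom_apply, stepElement, ← Fin.sum_univ_eq_sum_range
      (fun j => f j • ((e ((j + 1 : ℕ) / N)).1 - (e ((j : ℕ) / N)).1))]

/-- Puts two consecutive dyadic levels on one grid, where a single homomorphism compares them. -/
theorem stepElement_refine (e : ℝ → Proj M) (N : ℕ) (f : ℕ → ℂ) :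
    stepElement e N f = stepElement e (2 * N) fun j => f (j / 2) := by
  rw [stepElement, stepElement, sum_range_two_mul]
  refine Finset.sum_congr rfl fun j _ => ?_
  have h1 : 2 * j / 2 = j := by lia
  have h2 : (2 * j + 1) / 2 = j := by lia
  have h3 : ((2 * j + 1 + 1 : ℕ) : ℝ) / (2 * N : ℕ) = (j + 1 : ℕ) / N := by
    rw [← mul_div_mul_left ((j + 1 : ℕ) : ℝ) (N : ℝ) two_ne_zero]; push_cast; ring_nf
  have h4 : ((2 * j : ℕ) : ℝ) / (2 * N : ℕ) = j / N := by
    rw [← mul_div_mul_left (j : ℝ) (N : ℝ) two_ne_zero]; push_cast; ring_nf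
  rw [h1, h2, h3, h4, ← smul_add]
  congr 1
  abel

/-- A monotone family of projections with `τ(e_t) = t` carries a Haar unitary `∫ exp(2πit) de_t`,
approximated by the dyadic step unitaries. -/
theorem exists_haar_of_flow {e : ℝ → Proj M} (he : Monotone e)
    (hτ : ∀ t ∈ Set.Icc (0 : ℝ) 1, τ.toLin (e t).1 = t) :
    ∃ v ∈ τ.haarUnitaries, ∀ m : ℕ,
      ‖stepElement e (2 ^ m) (fun j => circlePt (j / (2 ^ m : ℕ))) - v‖ ≤ 2 * Real.pi / 2 ^ m := by
  have h0 : (e 0).1 = 0 := τ.eq_zero_of_re_toLin_eq_zero (e 0).2 (by rw [hτ 0 (by simp)]; simp)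
  have h1 : (e 1).1 = 1 := by
    refine (sub_eq_zero.1 (τ.eq_zero_of_re_toLin_eq_zero (e 1).2.one_sub ?_)).symm
    rw [map_sub, hτ 1 (by simp), τ.map_one]
    simp
  set v : ℕ → M.toStarSubalgebra := fun m =>
    stepElement e (2 ^ m) (fun j => circlePt (j / (2 ^ m : ℕ))) with hv
  have hunit : ∀ m, v m ∈ unitary M.toStarSubalgebra := by
    intro m
    obtain ⟨φ, hφ⟩ := exists_stepHom he h0 h1 (N := 2 ^ m) (by positivity)
    simp only [hv, ← hφ]
    refine Unitary.map_mem φ ?_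
    rw [Unitary.mem_iff]
    have := fun j : Fin (2 ^ m) => star_circlePt_mul_self (j / (2 ^ m : ℕ))
    exact ⟨funext this, funext fun j => (mul_comm _ _).trans (this j)⟩
  -- Level `m` kills only the powers below `2 ^ m`; every fixed `k` is reached for large `m`, so the
  -- limit is Haar.
  have hpow : ∀ m k : ℕ, 0 < k → k < 2 ^ m → τ.toLin (v m ^ k) = 0 := by
    intro m k hk hkm
    obtain ⟨φ, hφ⟩ := exists_stepHom he h0 h1 (N := 2 ^ m) (by positivity)
    simp only [hv, ← hφ, ← map_pow]
    have : ((fun j : Fin (2 ^ m) => circlePt ((j : ℕ) / (2 ^ m : ℕ))) ^ k) =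
        fun j : Fin (2 ^ m) => circlePt ((j : ℕ) / (2 ^ m : ℕ)) ^ k := rfl
    rw [this, hφ fun i : ℕ => circlePt (i / (2 ^ m : ℕ)) ^ k, stepElement, map_sum]
    have hj : ∀ j ∈ Finset.range (2 ^ m), τ.toLin (circlePt (j / (2 ^ m : ℕ)) ^ k •
        ((e ((j + 1 : ℕ) / (2 ^ m : ℕ))).1 - (e ((j : ℕ) / (2 ^ m : ℕ))).1)) =
        circlePt (j / (2 ^ m : ℕ)) ^ k * (1 / (2 ^ m : ℕ) : ℝ) := by
      intro j hj
      rw [Finset.mem_range] at hj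
      have hp : (0 : ℝ) < (2 ^ m : ℕ) := by positivity
      rw [map_smul, smul_eq_mul, map_sub, hτ _ ⟨by positivity, ?_⟩, hτ _ ⟨by positivity, ?_⟩,
        ← Complex.ofReal_sub, ← sub_div]
      · push_cast; ring
      · rw [div_le_one hp]; exact_mod_cast hj.le
      · rw [div_le_one hp]; exact_mod_cast hj
    rw [Finset.sum_congr rfl hj, ← Finset.sum_mul, sum_circlePt_pow_eq_zero hk hkm, zero_mul]
  -- On the finer grid the two sample points differ by at most one cell, `1 / 2 ^ (m + 1)`, and
  -- `circlePt` is `2π`-Lipschitz. The geometric tail then sums to `2π / 2 ^ m`.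
  have hdist : ∀ m, dist (v m) (v (m + 1)) ≤ 2 * Real.pi / 2 / 2 ^ m := by
    intro m
    obtain ⟨φ, hφ⟩ := exists_stepHom he h0 h1 (N := 2 * 2 ^ m) (by positivity)
    simp only [hv, pow_succ', stepElement_refine e (2 ^ m), ← hφ]
    rw [dist_eq_norm, ← map_sub]
    refine (NonUnitalStarAlgHom.norm_apply_le φ _).trans
      ((pi_norm_le_iff_of_nonneg (by positivity)).2 fun j => ?_)
    refine (norm_circlePt_sub_le _ _).trans ?_
    have h2 : ((j / 2 : ℕ) : ℝ) / (2 ^ m : ℕ) - j / (2 * 2 ^ m : ℕ) =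
        (2 * (j / 2 : ℕ) - j) / (2 * 2 ^ m) := by push_cast; field_simp
    have h3 : |(2 * ((j / 2 : ℕ) : ℝ) - (j : ℕ))| ≤ 1 := by
      have h4 : (2 * ((j.1 / 2 : ℕ) : ℤ) - (j : ℕ) : ℤ) = 0 ∨
        (2 * ((j.1 / 2 : ℕ) : ℤ) - (j : ℕ) : ℤ) = -1 := by lia
      rcases h4 with h4 | h4
      · have : (2 * ((j.1 / 2 : ℕ) : ℝ) - (j : ℕ) : ℝ) = 0 := by exact_mod_cast h4
        rw [this]; simp
      · have : (2 * ((j.1 / 2 : ℕ) : ℝ) - (j : ℕ) : ℝ) = -1 := by exact_mod_cast h4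
        rw [this]; simp
    rw [h2, abs_div, abs_of_pos (show (0 : ℝ) < 2 * 2 ^ m by positivity), div_div]
    rw [mul_div_assoc']
    exact div_le_div_of_nonneg_right (mul_le_of_le_one_right (by positivity) h3) (by positivity)
  obtain ⟨w, hw⟩ := cauchySeq_tendsto_of_complete (cauchySeq_of_le_geometric_two hdist)
  refine ⟨w, ⟨?_, fun k hk => ?_⟩, fun m => ?_⟩
  · have hc : IsClosed (unitary M.toStarSubalgebra : Set M.toStarSubalgebra) := isClosed_unitary
    exact hc.mem_of_tendsto hw (.of_forall hunit)
  · refine tendsto_nhds_unique ((τ.continuous_toLin.tendsto _).comp (hw.pow k)) ?_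
    refine tendsto_const_nhds.congr' ?_
    filter_upwards [eventually_ge_atTop k] with m hm
    exact (hpow m k hk (hm.trans_lt m.lt_two_pow_self)).symm
  · rw [← dist_eq_norm]
    exact dist_le_of_le_geometric_two_of_tendsto hdist hw m

end FaithfulNormalTrace


/-! ### Ramps and spectral projections -/

/-- The continuous piecewise linear function that is `1` on `(-∞, l]` and `0` on `[l + δ, ∞)`. -/
def ramp (l δ t : ℝ) : ℝ := 1 - max (t - l) 0 * (max δ (t - l))⁻¹

theorem continuous_ramp (l : ℝ) {δ : ℝ} (hδ : 0 < δ) : Continuous (ramp l δ) := by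
  unfold ramp
  have : ∀ t, max δ (t - l) ≠ 0 := fun t => (hδ.trans_le (le_max_left _ _)).ne'
  fun_prop (disch := assumption)

theorem ramp_of_le {l δ t : ℝ} (h : t ≤ l) : ramp l δ t = 1 := by
  rw [ramp, max_eq_right (sub_nonpos.2 h), zero_mul, sub_zero]

theorem ramp_of_ge {l δ t : ℝ} (hδ : 0 < δ) (h : l + δ ≤ t) : ramp l δ t = 0 := by
  rw [ramp, max_eq_left (by linarith), max_eq_right (by linarith),
    mul_inv_cancel₀ (by linarith : 0 < t - l).ne', sub_self]

theorem ramp_mem_Icc (l : ℝ) {δ : ℝ} (hδ : 0 < δ) (t : ℝ) : ramp l δ t ∈ Set.Icc (0 : ℝ) 1 := by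
  have h : 0 < max δ (t - l) := hδ.trans_le (le_max_left _ _)
  refine ⟨sub_nonneg.2 ?_, sub_le_self _ (by positivity)⟩
  rw [← div_eq_mul_inv, div_le_one h]
  exact max_le (le_max_right _ _) h.le

/-- Summation by parts: it trades increments of projections for the projections themselves, which
can be compared one by one with ramps of `a`. -/
theorem sum_range_smul_sub {A : Type*} [AddCommGroup A] [Module ℂ A] (f : ℕ → ℂ) (c : ℕ → A)
    (n : ℕ) : ∑ j ∈ Finset.range (n + 1), f j • (c (j + 1) - c j) =
      f n • c (n + 1) - f 0 • c 0 - ∑ j ∈ Finset.range n, (f (j + 1) - f j) • c (j + 1) := by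
  induction n with
  | zero => simp [smul_sub]
  | succ n ih =>
    rw [Finset.sum_range_succ, ih, Finset.sum_range_succ]
    module

section Spectral

variable {H : Type*} [NormedAddCommGroup H] [InnerProductSpace ℂ H] [CompleteSpace H]
  {M : VonNeumannAlgebra H}

/-- The spectral projection of a self-adjoint element for the half-line `(-∞, l]`. -/
def spectralProj (a : M.toStarSubalgebra) (l : ℝ) : Proj M :=
  haveI : CompleteSpace ((cfc (fun t : ℝ => max (t - l) 0) a).1 : H →L[ℂ] H).ker :=
    (ContinuousLinearMap.isClosed_ker _).completeSpace_coe
  projOfInvariant ((cfc (fun t : ℝ => max (t - l) 0) a).1 : H →L[ℂ] H).ker fun y hy x hx => by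
    have h := DFunLike.congr_fun
      (commute_of_mem_commutant (cfc (fun t : ℝ => max (t - l) 0) a).2 hy).eq x
    have h2 : (cfc (fun t : ℝ => max (t - l) 0) a).1 x = 0 := hx
    change (cfc (fun t : ℝ => max (t - l) 0) a).1 (y x) = 0
    exact h.trans (by simp [h2])

theorem mul_spectralProj_eq_zero (a : M.toStarSubalgebra) (l : ℝ) :
    cfc (fun t : ℝ => max (t - l) 0) a * (spectralProj a l).1 = 0 := by
  have : CompleteSpace ((cfc (fun t : ℝ => max (t - l) 0) a).1 : H →L[ℂ] H).ker :=
    (ContinuousLinearMap.isClosed_ker _).completeSpace_coe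
  refine Subtype.ext (ContinuousLinearMap.ext fun x => ?_)
  exact Submodule.starProjection_apply_mem ((cfc (fun t : ℝ => max (t - l) 0) a).1 : H →L[ℂ] H).ker x

theorem spectralProj_mul_eq {a x : M.toStarSubalgebra} {l : ℝ}
    (h : cfc (fun t : ℝ => max (t - l) 0) a * x = 0) : (spectralProj a l).1 * x = x := by
  have : CompleteSpace ((cfc (fun t : ℝ => max (t - l) 0) a).1 : H →L[ℂ] H).ker :=
    (ContinuousLinearMap.isClosed_ker _).completeSpace_coe
  refine Subtype.ext (ContinuousLinearMap.ext fun v => ?_)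
  exact Submodule.starProjection_eq_self_iff.2 (DFunLike.congr_fun (congrArg Subtype.val h) v)

/-- The formula for `ramp` exhibits `1 - ramp` as a multiple of the positive part of `t - l`, whose
value at `a` vanishes on the range of the spectral projection. -/
theorem cfc_ramp_mul_spectralProj {a : M.toStarSubalgebra} (ha : IsSelfAdjoint a) (l : ℝ)
    {δ : ℝ} (hδ : 0 < δ) :
    cfc (ramp l δ) a * (spectralProj a l).1 = (spectralProj a l).1 := by
  have hc : Continuous fun t : ℝ => (max δ (t - l))⁻¹ := by
    have : ∀ t, max δ (t - l) ≠ 0 := fun t => (hδ.trans_le (le_max_left _ _)).ne'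
    fun_prop (disch := assumption)
  have : cfc (ramp l δ) a = 1 - cfc (fun t : ℝ => (max δ (t - l))⁻¹) a *
      cfc (fun t : ℝ => max (t - l) 0) a := by
    rw [← cfc_mul _ _ a hc.continuousOn (by fun_prop), ← cfc_one ℝ a, ← cfc_sub _ _ a
      (by fun_prop) (by fun_prop)]
    refine cfc_congr fun t _ => ?_
    simp [ramp, mul_comm]
  rw [this, sub_mul, mul_assoc, mul_spectralProj_eq_zero, mul_zero, sub_zero, one_mul]

theorem spectralProj_mul_cfc_ramp (a : M.toStarSubalgebra) (l : ℝ)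
    {δ : ℝ} (hδ : 0 < δ) :
    (spectralProj a l).1 * cfc (ramp (l - δ) δ) a = cfc (ramp (l - δ) δ) a := by
  refine spectralProj_mul_eq ?_
  rw [← cfc_mul _ _ a (by fun_prop) (continuous_ramp _ hδ).continuousOn, ← cfc_zero ℝ a]
  refine cfc_congr fun t _ => ?_
  rcases le_total t l with h | h
  · simp [h]
  · simp [ramp_of_ge hδ (show l - δ + δ ≤ t by linarith)]

/-- For `l < m`, the ramp of width `m - l` at `l` fixes the smaller projection, and its product with
the positive part of `t - m` is zero. -/
theorem spectralProj_mono {a : M.toStarSubalgebra} (ha : IsSelfAdjoint a) : Monotone (spectralProj a) := by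
  refine monotone_iff_forall_lt.2 fun l m hlm => ?_
  have hδ := sub_pos.2 hlm
  refine (((spectralProj a l).2.le_iff_mul_eq_right (spectralProj a m).2).2 ?_ :
    (spectralProj a l).1 ≤ (spectralProj a m).1)
  refine spectralProj_mul_eq ?_
  rw [← cfc_ramp_mul_spectralProj ha l hδ, ← mul_assoc,
    ← cfc_mul _ _ a (by fun_prop) (continuous_ramp _ hδ).continuousOn]
  have : cfc (fun t : ℝ => max (t - m) 0 * ramp l (m - l) t) a = 0 := by
    rw [← cfc_zero ℝ a]
    refine cfc_congr fun t _ => ?_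
    rcases le_total t m with h | h
    · simp [h]
    · simp [ramp_of_ge hδ (show l + (m - l) ≤ t by linarith)]
  rw [this, zero_mul]

/-- With `F` the ramp of `a` and `p` the projection, `F p = p` gives `F - p = (1 - p) F (1 - p) ≥
0`. -/
theorem spectralProj_le_cfc_ramp {a : M.toStarSubalgebra} (ha : IsSelfAdjoint a) (l : ℝ)
    {δ : ℝ} (hδ : 0 < δ) :
    (spectralProj a l).1 ≤ cfc (ramp l δ) a := by
  have h1 := cfc_ramp_mul_spectralProj ha l hδ
  have h0 : 0 ≤ cfc (ramp l δ) a := cfc_nonneg fun t _ => (ramp_mem_Icc l hδ t).1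
  have h2 : (spectralProj a l).1 * cfc (ramp l δ) a = (spectralProj a l).1 := by
    simpa [(spectralProj a l).2.isSelfAdjoint.star_eq, h0.isSelfAdjoint.star_eq] using congrArg star h1
  have h3 := star_left_conjugate_nonneg h0 (1 - (spectralProj a l).1)
  have h4 : star (1 - (spectralProj a l).1) * cfc (ramp l δ) a * (1 - (spectralProj a l).1) =
      cfc (ramp l δ) a - (spectralProj a l).1 := by
    rw [(spectralProj a l).2.one_sub.isSelfAdjoint.star_eq, sub_mul, one_mul, h2, mul_sub, mul_one,
      sub_mul, h1, (spectralProj a l).2.isIdempotentElem.eq, sub_self, sub_zero]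
  rw [h4] at h3
  exact sub_nonneg.1 h3

end Spectral

/-! ### A Haar unitary near a step approximation -/

namespace FaithfulNormalTrace

variable {H : Type*} [NormedAddCommGroup H] [InnerProductSpace ℂ H] [CompleteSpace H]
  {M : VonNeumannAlgebra H} (τ : FaithfulNormalTrace M)

/-- Since `p F = F p = F`, the square `(p - F)²` equals `(p - F) - (F - F²)`, and `F² ≤ F` because
ramps take values in `[0, 1]`. -/
theorem norm2_spectralProj_sub_sq_le (a : M.toStarSubalgebra) (l : ℝ)
    {δ : ℝ} (hδ : 0 < δ) :
    τ.norm2 ((spectralProj a l).1 - cfc (ramp (l - δ) δ) a) ^ 2 ≤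
      (τ.toLin (spectralProj a l).1).re - (τ.toLin (cfc (ramp (l - δ) δ) a)).re := by
  set p := (spectralProj a l).1
  have hp : IsStarProjection p := (spectralProj a l).2
  set F := cfc (ramp (l - δ) δ) a with hF
  have h0 : 0 ≤ F := cfc_nonneg fun t _ => (ramp_mem_Icc _ hδ t).1
  have h1 : p * F = F := spectralProj_mul_cfc_ramp a l hδ
  have h2 : F * p = F := by
    simpa [hp.isSelfAdjoint.star_eq, h0.isSelfAdjoint.star_eq] using congrArg star h1
  have hc := (continuous_ramp (l - δ) hδ).continuousOn (s := spectrum ℝ a)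
  have h3 : F * F ≤ F := by
    rw [hF, ← cfc_mul _ _ a hc hc]
    refine cfc_mono (fun t _ => ?_) (hc.mul hc) hc
    have := ramp_mem_Icc (l - δ) hδ t
    exact mul_le_of_le_one_left this.1 this.2
  have h4 : star (p - F) * (p - F) = (p - F) - (F - F * F) := by
    rw [star_sub, hp.isSelfAdjoint.star_eq, h0.isSelfAdjoint.star_eq, sub_mul, mul_sub, mul_sub,
      hp.isIdempotentElem.eq, h1, h2]
  have h5 := τ.re_toLin_mono h3
  rw [norm2_sq, h4]
  simp only [map_sub, Complex.sub_re]
  linarith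

/-- The step approximation of `exp(2πia)` built from continuous functions of `a`. -/
def smoothStep (n : ℕ) (δ : ℝ) (a : M.toStarSubalgebra) : M.toStarSubalgebra :=
  circlePt (n / (n + 1 : ℕ)) • 1 - ∑ j ∈ Finset.range n,
    (circlePt ((j + 1 : ℕ) / (n + 1 : ℕ)) - circlePt (j / (n + 1 : ℕ))) •
      cfc (ramp ((j + 1 : ℕ) / (n + 1 : ℕ) - δ) δ) a

/-- If the distribution of `a` is almost uniform on `[0, 1]`, then `smoothStep` is close to a Haar
unitary. -/
theorem exists_haar_near_smoothStep (hM : IsDiffuse M) {a : M.toStarSubalgebra}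
    (ha : IsSelfAdjoint a) {n m : ℕ} (hn : n + 1 = 2 ^ m) {δ η : ℝ} (hδ : 0 < δ)
    (h1 : ∀ j ∈ Finset.range n, |(τ.toLin (cfc (ramp ((j + 1 : ℕ) / (n + 1 : ℕ) - δ) δ) a)).re -
      (j + 1 : ℕ) / (n + 1 : ℕ)| ≤ η)
    (h2 : ∀ j ∈ Finset.range n, |(τ.toLin (cfc (ramp ((j + 1 : ℕ) / (n + 1 : ℕ)) δ) a)).re -
      (j + 1 : ℕ) / (n + 1 : ℕ)| ≤ η) :
    ∃ v ∈ τ.haarUnitaries,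
      τ.norm2 (v - smoothStep n δ a) ≤ 2 * Real.pi / 2 ^ m + n * (2 * (2 * √(2 * η))) := by
  -- Running the flow through the spectral projections of `a` makes each `e l` comparable with the
  -- spectral projection at `l`.
  obtain ⟨e, heτ, hemono, he⟩ := τ.exists_flow hM
    (S := Set.range (spectralProj a)) (spectralProj_mono ha).isChain_range
  obtain ⟨v, hv, hvm⟩ := τ.exists_haar_of_flow hemono heτ
  refine ⟨v, hv, ?_⟩
  have h0 : (e 0).1 = 0 := τ.eq_zero_of_re_toLin_eq_zero (e 0).2 (by rw [heτ 0 (by simp)]; simp)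
  have h1' : (e 1).1 = 1 := by
    refine (sub_eq_zero.1 (τ.eq_zero_of_re_toLin_eq_zero (e 1).2.one_sub ?_)).symm
    rw [map_sub, heτ 1 (by simp), τ.map_one]
    simp
  have hN : ((n + 1 : ℕ) : ℝ) ≠ 0 := by positivity
  have hstep : stepElement e (2 ^ m) (fun j => circlePt (j / (2 ^ m : ℕ))) =
      circlePt (n / (n + 1 : ℕ)) • 1 - ∑ j ∈ Finset.range n,
        (circlePt ((j + 1 : ℕ) / (n + 1 : ℕ)) - circlePt (j / (n + 1 : ℕ))) •
          (e ((j + 1 : ℕ) / (n + 1 : ℕ))).1 := by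
    rw [← hn, stepElement, sum_range_smul_sub (fun j : ℕ => circlePt (j / (n + 1 : ℕ)))
      (fun j : ℕ => (e (j / (n + 1 : ℕ))).1), div_self hN, h1']
    simp [h0]
  -- The trace of the spectral projection is squeezed between those of the ramps ending and starting
  -- at `l`, both within `η` of `l`. Hence the projection is within `√(2η)` of the lower ramp and of
  -- `e l`.
  have hterm : ∀ j ∈ Finset.range n, τ.norm2 (cfc (ramp ((j + 1 : ℕ) / (n + 1 : ℕ) - δ) δ) a -
      (e ((j + 1 : ℕ) / (n + 1 : ℕ))).1) ≤ 2 * √(2 * η) := by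
    intro j hj
    have b1 := abs_le.1 (h1 j hj)
    have b2 := abs_le.1 (h2 j hj)
    set l : ℝ := (j + 1 : ℕ) / (n + 1 : ℕ) with hl
    have hl01 : l ∈ Set.Icc (0 : ℝ) 1 := by
      refine ⟨by positivity, ?_⟩
      rw [hl, div_le_one (by positivity)]
      have := Finset.mem_range.1 hj
      exact_mod_cast (by lia : j + 1 ≤ n + 1)
    have c1 := τ.norm2_spectralProj_sub_sq_le a l hδ
    have c2 := τ.re_toLin_mono (spectralProj_le_cfc_ramp ha l hδ)
    have c3 := τ.norm2_sub_sq_of_le_or_le (spectralProj a l).2 (e l).2 (he l _ ⟨l, rfl⟩)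
    rw [heτ l hl01, Complex.ofReal_re] at c3
    have c4 : τ.norm2 ((spectralProj a l).1 - cfc (ramp (l - δ) δ) a) ≤ √(2 * η) :=
      Real.le_sqrt_of_sq_le (by linarith)
    have c5 : τ.norm2 ((spectralProj a l).1 - (e l).1) ≤ √(2 * η) := by
      refine Real.le_sqrt_of_sq_le ?_
      rw [c3]
      have := sq_nonneg (τ.norm2 ((spectralProj a l).1 - cfc (ramp (l - δ) δ) a))
      rw [abs_le]
      constructor <;> linarith
    rw [norm2_sub_comm] at c4
    linarith [τ.norm2_sub_le (cfc (ramp (l - δ) δ) a) (spectralProj a l).1 (e l).1]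
  have hmain : τ.norm2 (stepElement e (2 ^ m) (fun j => circlePt (j / (2 ^ m : ℕ))) -
      smoothStep n δ a) ≤ n * (2 * (2 * √(2 * η))) := by
    rw [hstep, smoothStep, sub_sub_sub_cancel_left, ← Finset.sum_sub_distrib]
    refine (τ.norm2_sum_le _ _).trans ?_
    refine (Finset.sum_le_card_nsmul _ _ (2 * (2 * √(2 * η))) fun j hj => ?_).trans (by simp)
    rw [← smul_sub, norm2_smul]
    refine mul_le_mul ?_ (hterm j hj) (τ.norm2_nonneg _) zero_le_two
    refine (norm_sub_le _ _).trans ?_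
    rw [norm_circlePt, norm_circlePt]
    norm_num
  have h3 := τ.norm2_sub_le v (stepElement e (2 ^ m) (fun j => circlePt (j / (2 ^ m : ℕ))))
    (smoothStep n δ a)
  have h4 := (τ.norm2_le_norm _).trans (hvm m)
  rw [norm2_sub_comm] at h4
  linarith

end FaithfulNormalTrace


/-! ### Laurent and trigonometric polynomials -/

section LaurentPolynomials

open AddMonoidAlgebra

variable {B : Type*} [Ring B] [StarRing B] [Algebra ℂ B] [StarModule ℂ B]

/-- Laurent polynomials `∑ c_k z^k`. -/
abbrev LPoly : Type := AddMonoidAlgebra ℂ ℤ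

/-- The Laurent polynomial `∑ conj(c_k) z^{-k}`. -/
def LPoly.conj (p : LPoly) : LPoly := p.coeff.sum fun k c => single (-k) (star c)

/-- The self-conjugate part of a Laurent polynomial. -/
def LPoly.re (p : LPoly) : LPoly := (2⁻¹ : ℂ) • (p + p.conj)

theorem lift_conj {F : Multiplicative ℤ →* B} (hF : ∀ k, star (F k) = F k⁻¹) (p : LPoly) :
    lift ℂ B ℤ F p.conj = star (lift ℂ B ℤ F p) := by
  rw [LPoly.conj, Finsupp.sum, map_sum, lift_apply, Finsupp.sum, star_sum]
  refine Finset.sum_congr rfl fun k _ => ?_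
  rw [lift_single, star_smul, hF, ofAdd_neg]

theorem star_lift_re {F : Multiplicative ℤ →* B} (hF : ∀ k, star (F k) = F k⁻¹) (p : LPoly) :
    star (lift ℂ B ℤ F p.re) = lift ℂ B ℤ F p.re := by
  rw [LPoly.re, map_smul, map_add, lift_conj hF, star_smul, star_add, star_star, add_comm]
  congr 1
  simp

/-- The characters `θ ↦ exp(2πikθ)`. -/
def trigChar : Multiplicative ℤ →* (ℝ → ℂ) where
  toFun k θ := circlePt ((Multiplicative.toAdd k : ℤ) * θ)
  map_one' := by ext θ; simp [circlePt]
  map_mul' k l := by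
    ext θ
    rw [Pi.mul_apply, ← circlePt_add, toAdd_mul]
    push_cast
    ring_nf

theorem star_trigChar (k : Multiplicative ℤ) : star (trigChar k) = trigChar k⁻¹ := by
  ext θ
  have h := star_circlePt_mul_self ((Multiplicative.toAdd k : ℤ) * θ)
  have h2 : circlePt ((Multiplicative.toAdd k : ℤ) * θ) * trigChar k⁻¹ θ = 1 := by
    change (trigChar k * trigChar k⁻¹) θ = 1
    rw [← map_mul, mul_inv_cancel, map_one]
    rfl
  exact left_inv_eq_right_inv h h2

/-- The trigonometric polynomial `θ ↦ ∑ c_k exp(2πikθ)`. -/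
def trigEval : LPoly →ₐ[ℂ] (ℝ → ℂ) := lift ℂ (ℝ → ℂ) ℤ trigChar

theorem trigEval_single (k : ℤ) (c : ℂ) (θ : ℝ) :
    trigEval (single k c) θ = c * circlePt (k * θ) := by
  rw [trigEval, lift_single]
  rfl

theorem trigEval_conj (p : LPoly) (θ : ℝ) : trigEval p.conj θ = star (trigEval p θ) :=
  congrFun (lift_conj star_trigChar p) θ

theorem trigEval_re (p : LPoly) (θ : ℝ) : trigEval p.re θ = ((trigEval p θ).re : ℂ) := by
  rw [LPoly.re, map_smul, map_add, Pi.smul_apply, Pi.add_apply, trigEval_conj, Complex.star_def,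
    Complex.add_conj]
  simp

theorem continuous_circlePt : Continuous circlePt := by
  unfold circlePt
  fun_prop

theorem continuous_trigEval (p : LPoly) : Continuous (trigEval p) := by
  have : trigEval p = fun θ => ∑ k ∈ p.coeff.support, p.coeff k • circlePt (k * θ) := by
    ext θ
    rw [trigEval, lift_apply, Finsupp.sum, Finset.sum_apply]
    rfl
  rw [this]
  have := continuous_circlePt
  fun_prop

end LaurentPolynomials

/-! ### Approximating the logarithm by trigonometric polynomials -/

open MeasureTheory

/-- Lebesgue measure on `(0, 1]`. -/
abbrev μI : Measure ℝ := volume.restrict (Set.Ioc 0 1)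

instance : IsProbabilityMeasure μI := ⟨by simp⟩

theorem integral_circlePt (k : ℤ) (hk : k ≠ 0) : ∫ θ, circlePt (k * θ) ∂μI = 0 := by
  rw [← intervalIntegral.integral_of_le zero_le_one]
  have hc : (2 * Real.pi * k * Complex.I : ℂ) ≠ 0 := by
    have := Real.pi_ne_zero
    simp [hk, Complex.I_ne_zero]
  have h1 : ∀ θ : ℝ, circlePt (k * θ) = Complex.exp ((2 * Real.pi * k * Complex.I : ℂ) * θ) := by
    intro θ
    rw [circlePt]
    congr 1
    push_cast
    ring
  simp_rw [h1]
  rw [integral_exp_mul_complex hc]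
  have h2 : (2 * Real.pi * k * Complex.I : ℂ) = k * (2 * Real.pi * Complex.I) := by ring
  simp only [Complex.ofReal_one, mul_one, Complex.ofReal_zero, mul_zero, Complex.exp_zero]
  rw [h2, Complex.exp_int_mul_two_pi_mul_I, sub_self, zero_div]

/-- Some trigonometric polynomials converge to the identity function almost everywhere on
`(0, 1]`. -/
theorem exists_trigEval_tendsto : ∃ p : ℕ → LPoly, ∀ᵐ θ ∂μI,
    Tendsto (fun k => trigEval (p k) θ) atTop (𝓝 (θ : ℂ)) := by
  let f : UnitAddCircle → ℂ := fun x => ((AddCircle.equivIoc (1 : ℝ) 0 x : ℝ) : ℂ)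
  have hf : MemLp f 2 (AddCircle.haarAddCircle (T := 1)) := by
    refine MemLp.of_bound (C := 1) ?_ (.of_forall fun x => ?_)
    · refine Measurable.aestronglyMeasurable ?_
      exact Complex.measurable_ofReal.comp
        (measurable_subtype_coe.comp (AddCircle.measurableEquivIoc (1 : ℝ) 0).measurable)
    · have h := (AddCircle.equivIoc (1 : ℝ) 0 x).2
      rw [Complex.norm_real, Real.norm_eq_abs, abs_of_pos h.1]
      simpa using h.2
  have hs := hasSum_fourier_series_L2 (hf.toLp f)
  obtain ⟨s, hs'⟩ := Filter.exists_seq_tendsto (atTop : Filter (Finset ℤ))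
  set c := fourierCoeff (hf.toLp f) with hc
  -- The function jumps on the circle, so uniform convergence fails; `L²` convergence of its Fourier
  -- series still gives convergence in measure, hence almost everywhere along a subsequence.
  have ht := tendstoInMeasure_of_tendsto_Lp (hs.comp hs')
  obtain ⟨ns, -, hns⟩ := ht.exists_seq_tendsto_ae
  refine ⟨fun k => ∑ i ∈ s (ns k), AddMonoidAlgebra.single i (c i), ?_⟩
  have hsum : ∀ t : Finset ℤ, (∑ i ∈ t, c i • fourierLp (T := 1) 2 i : Lp ℂ 2 _) =ᵐ[
      AddCircle.haarAddCircle (T := 1)] fun x => ∑ i ∈ t, c i * fourier i x := by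
    intro t
    have : (∑ i ∈ t, c i • fourierLp (T := 1) 2 i : Lp ℂ 2 _) =
        ContinuousMap.toLp (E := ℂ) 2 AddCircle.haarAddCircle ℂ (∑ i ∈ t, c i • fourier i) := by
      rw [map_sum]
      simp_rw [map_smul]
    rw [this]
    refine (ContinuousMap.coeFn_toLp _ _).trans (.of_forall fun x => ?_)
    simp
  have hae : ∀ᵐ x ∂(AddCircle.haarAddCircle (T := 1)),
      Tendsto (fun k => ∑ i ∈ s (ns k), c i * fourier i x) atTop (𝓝 (f x)) := by
    filter_upwards [hns, hf.coeFn_toLp, ae_all_iff.2 fun k => hsum (s (ns k))] with x h1 h2 h3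
    rw [← h2]
    refine h1.congr fun k => ?_
    exact h3 k
  have hvol : ∀ᵐ x ∂(volume : Measure UnitAddCircle),
      Tendsto (fun k => ∑ i ∈ s (ns k), c i * fourier i x) atTop (𝓝 (f x)) := by
    rw [AddCircle.volume_eq_smul_haarAddCircle]
    exact Measure.ae_smul_measure hae _
  have hmp := AddCircle.measurePreserving_mk (1 : ℝ) 0
  rw [zero_add] at hmp
  filter_upwards [hmp.quasiMeasurePreserving.ae hvol, ae_restrict_mem measurableSet_Ioc] with θ h hθ
  have hfθ : f θ = θ := by
    simp only [f]
    rw [AddCircle.equivIoc_coe_of_mem (by simpa using hθ)]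
  rw [hfθ] at h
  refine h.congr fun k => ?_
  rw [map_sum, Finset.sum_apply]
  refine Finset.sum_congr rfl fun i _ => ?_
  rw [trigEval_single, fourier_coe_apply, circlePt]
  congr 2
  push_cast
  ring

theorem tendsto_ramp {l θ : ℝ} (h : θ ≠ l) {t : ℕ → ℝ} (ht : Tendsto t atTop (𝓝 θ)) {δ : ℕ → ℝ}
    (hδ : ∀ k, 0 < δ k) (hδ0 : Tendsto δ atTop (𝓝 0)) :
    Tendsto (fun k => ramp l (δ k) (t k)) atTop (𝓝 (if θ < l then 1 else 0)) ∧
    Tendsto (fun k => ramp (l - δ k) (δ k) (t k)) atTop (𝓝 (if θ < l then 1 else 0)) := by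
  rcases lt_or_gt_of_ne h with h | h
  · have h1 : ∀ᶠ k in atTop, t k + δ k < l := (ht.add hδ0).eventually_lt_const (by simpa)
    rw [if_pos h]
    constructor <;> refine tendsto_const_nhds.congr' ?_ <;> filter_upwards [h1] with k hk
    · exact (ramp_of_le (by linarith [hδ k])).symm
    · exact (ramp_of_le (by linarith [hδ k])).symm
  · have h1 : ∀ᶠ k in atTop, l < t k - δ k := (ht.sub hδ0).eventually_const_lt (by simpa)
    rw [if_neg h.not_gt]
    constructor <;> refine tendsto_const_nhds.congr' ?_ <;> filter_upwards [h1] with k hk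
    · exact (ramp_of_ge (hδ k) (by linarith [hδ k])).symm
    · exact (ramp_of_ge (hδ k) (by linarith [hδ k])).symm

theorem integral_indicator_lt {l : ℝ} (hl : l ∈ Set.Icc (0 : ℝ) 1) :
    ∫ θ, (if θ < l then 1 else 0 : ℝ) ∂μI = l := by
  have : (fun θ : ℝ => (if θ < l then 1 else 0 : ℝ)) = (Set.Iio l).indicator fun _ => 1 := by
    ext θ
    simp [Set.indicator_apply]
  rw [this, integral_indicator_const _ measurableSet_Iio, Measure.real,
    Measure.restrict_apply measurableSet_Iio]
  have : Set.Iio l ∩ Set.Ioc 0 1 = Set.Ioo 0 l := by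
    ext θ
    simp only [Set.mem_inter_iff, Set.mem_Iio, Set.mem_Ioc, Set.mem_Ioo]
    exact ⟨fun h => ⟨h.2.1, h.1⟩, fun h => ⟨h.2, h.1, h.2.le.trans hl.2⟩⟩
  rw [this]
  simp [hl.1]

/-- The step approximation of `exp(2πit)` by continuous functions. -/
def smoothStepFun (n : ℕ) (δ t : ℝ) : ℂ :=
  circlePt (n / (n + 1 : ℕ)) - ∑ j ∈ Finset.range n,
    (circlePt ((j + 1 : ℕ) / (n + 1 : ℕ)) - circlePt (j / (n + 1 : ℕ))) *
      (ramp ((j + 1 : ℕ) / (n + 1 : ℕ) - δ) δ t : ℂ)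

/-- The sum telescopes to the value of `circlePt` at the left endpoint of the cell containing `θ`,
at distance at most `1 / (n + 1)` from `θ`. -/
theorem norm_step_sub_circlePt_le (n : ℕ) {θ : ℝ} (hθ : θ ∈ Set.Ioo (0 : ℝ) 1) :
    ‖circlePt (n / (n + 1 : ℕ)) - ∑ j ∈ Finset.range n,
    (circlePt ((j + 1 : ℕ) / (n + 1 : ℕ)) - circlePt (j / (n + 1 : ℕ))) *
      ((if θ < (j + 1 : ℕ) / (n + 1 : ℕ) then 1 else 0 : ℝ) : ℂ) - circlePt θ‖ ≤
      2 * Real.pi / (n + 1 : ℕ) := by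
  have hN : (0 : ℝ) < (n + 1 : ℕ) := by positivity
  set i : ℕ := ⌊θ * (n + 1 : ℕ)⌋₊ with hi
  have hi1 : i ≤ n := by
    refine Nat.lt_succ_iff.1 ((Nat.floor_lt (by have := hθ.1; positivity)).2 ?_)
    exact mul_lt_of_lt_one_left hN hθ.2
  have hlt : ∀ j : ℕ, θ < (j + 1 : ℕ) / (n + 1 : ℕ) ↔ i ≤ j := fun j => by
    rw [lt_div_iff₀ hN, ← Nat.lt_succ_iff, hi, Nat.floor_lt (by have := hθ.1; positivity)]
  have hsum : ∑ j ∈ Finset.range n,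
      (circlePt ((j + 1 : ℕ) / (n + 1 : ℕ)) - circlePt (j / (n + 1 : ℕ))) *
      ((if θ < (j + 1 : ℕ) / (n + 1 : ℕ) then 1 else 0 : ℝ) : ℂ) =
      circlePt (n / (n + 1 : ℕ)) - circlePt (i / (n + 1 : ℕ)) := by
    -- Replacing `j` by `max i j` makes the terms with `j < i` vanish, which is the effect of the
    -- indicator.
    have := Finset.sum_range_sub (fun j : ℕ => circlePt ((max i j : ℕ) / (n + 1 : ℕ))) n
    rw [max_eq_right hi1, max_eq_left (Nat.zero_le i)] at this
    rw [← this]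
    refine Finset.sum_congr rfl fun j _ => ?_
    simp only [hlt]
    split_ifs with h
    · rw [max_eq_right h, max_eq_right (h.trans (Nat.le_succ j))]; simp
    · rw [max_eq_left (by lia), max_eq_left (by lia)]; simp
  rw [hsum, sub_sub_cancel]
  refine (norm_circlePt_sub_le _ _).trans ?_
  rw [← mul_one_div (2 * Real.pi)]
  refine mul_le_mul_of_nonneg_left ?_ Real.two_pi_pos.le
  have h1 := Nat.floor_le (show 0 ≤ θ * (n + 1 : ℕ) by have := hθ.1; positivity)
  have h2 := Nat.lt_floor_add_one (θ * (n + 1 : ℕ))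
  rw [← hi] at h1 h2
  rw [← div_le_iff₀ hN] at h1
  rw [← lt_div_iff₀ hN, add_div] at h2
  rw [abs_le]
  constructor <;> linarith

/-- Let the polynomials tend to the identity and the ramp width to zero together. Off the finitely
many jumps the ramps converge to indicators, so dominated convergence gives each of finitely many
strict inequalities eventually. -/
theorem exists_trig_approx (n : ℕ) {ε : ℝ} (hε : 0 < ε) : ∃ p : LPoly, ∃ δ > 0,
    (∀ j ∈ Finset.range n, |∫ θ, ramp ((j + 1 : ℕ) / (n + 1 : ℕ) - δ) δ (trigEval p θ).re ∂μI -
      (j + 1 : ℕ) / (n + 1 : ℕ)| < ε) ∧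
    (∀ j ∈ Finset.range n, |∫ θ, ramp ((j + 1 : ℕ) / (n + 1 : ℕ)) δ (trigEval p θ).re ∂μI -
      (j + 1 : ℕ) / (n + 1 : ℕ)| < ε) ∧
    ∫ θ, ‖smoothStepFun n δ (trigEval p θ).re - circlePt θ‖ ^ 2 ∂μI <
      (2 * Real.pi / (n + 1 : ℕ)) ^ 2 + ε := by
  obtain ⟨p, hp⟩ := exists_trigEval_tendsto
  let δ : ℕ → ℝ := fun k => 1 / ((k : ℝ) + 1)
  have hδ : ∀ k, 0 < δ k := fun k => Nat.one_div_pos_of_nat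
  have hδ0 : Tendsto δ atTop (𝓝 0) := tendsto_one_div_add_atTop_nhds_zero_nat
  have hp' : ∀ᵐ θ ∂μI, Tendsto (fun k => (trigEval (p k) θ).re) atTop (𝓝 θ) := by
    filter_upwards [hp] with θ h
    exact (Complex.continuous_re.tendsto _).comp h
  have hcp : ∀ k, Continuous fun θ => (trigEval (p k) θ).re := fun k =>
    Complex.continuous_re.comp (continuous_trigEval _)
  have hne : ∀ l : ℝ, ∀ᵐ θ ∂μI, θ ≠ l := fun l => Measure.ae_ne _ l
  have hb : ∀ l k t, ‖ramp l (δ k) t‖ ≤ 1 := fun l k t => by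
    have := ramp_mem_Icc l (hδ k) t
    rw [Real.norm_eq_abs, abs_of_nonneg this.1]
    exact this.2
  have hl : ∀ j ∈ Finset.range n, ((j + 1 : ℕ) / (n + 1 : ℕ) : ℝ) ∈ Set.Icc (0 : ℝ) 1 := by
    intro j hj
    refine ⟨by positivity, ?_⟩
    rw [div_le_one (by positivity)]
    have := Finset.mem_range.1 hj
    exact_mod_cast (by lia : j + 1 ≤ n + 1)
  have hmeas : ∀ (l : ℝ) k, Continuous fun θ => ramp l (δ k) (trigEval (p k) θ).re := fun l k =>
    (continuous_ramp l (hδ k)).comp (hcp k)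
  have e1 : ∀ j ∈ Finset.range n, ∀ᶠ k in atTop,
      |∫ θ, ramp ((j + 1 : ℕ) / (n + 1 : ℕ) - δ k) (δ k) (trigEval (p k) θ).re ∂μI -
      (j + 1 : ℕ) / (n + 1 : ℕ)| < ε := by
    intro j hj
    have : Tendsto (fun k => ∫ θ, ramp ((j + 1 : ℕ) / (n + 1 : ℕ) - δ k) (δ k)
        (trigEval (p k) θ).re ∂μI) atTop (𝓝 ((j + 1 : ℕ) / (n + 1 : ℕ))) := by
      nth_rw 2 [← integral_indicator_lt (hl j hj)]
      refine tendsto_integral_of_dominated_convergence (fun _ => 1)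
        (fun k => (hmeas _ k).aestronglyMeasurable) (integrable_const _)
        (fun k => .of_forall fun θ => hb _ k _) ?_
      filter_upwards [hp', hne _] with θ h1 h2
      exact (tendsto_ramp h2 h1 hδ hδ0).2
    simpa [Real.dist_eq] using Metric.tendsto_nhds.1 this ε hε
  have e2 : ∀ j ∈ Finset.range n, ∀ᶠ k in atTop,
      |∫ θ, ramp ((j + 1 : ℕ) / (n + 1 : ℕ)) (δ k) (trigEval (p k) θ).re ∂μI -
      (j + 1 : ℕ) / (n + 1 : ℕ)| < ε := by
    intro j hj
    have : Tendsto (fun k => ∫ θ, ramp ((j + 1 : ℕ) / (n + 1 : ℕ)) (δ k)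
        (trigEval (p k) θ).re ∂μI) atTop (𝓝 ((j + 1 : ℕ) / (n + 1 : ℕ))) := by
      nth_rw 2 [← integral_indicator_lt (hl j hj)]
      refine tendsto_integral_of_dominated_convergence (fun _ => 1)
        (fun k => (hmeas _ k).aestronglyMeasurable) (integrable_const _)
        (fun k => .of_forall fun θ => hb _ k _) ?_
      filter_upwards [hp', hne _] with θ h1 h2
      exact (tendsto_ramp h2 h1 hδ hδ0).1
    simpa [Real.dist_eq] using Metric.tendsto_nhds.1 this ε hε
  have e3 : ∀ᶠ k in atTop, ∫ θ, ‖smoothStepFun n (δ k) (trigEval (p k) θ).re - circlePt θ‖ ^ 2 ∂μI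
      < (2 * Real.pi / (n + 1 : ℕ)) ^ 2 + ε := by
    let G : ℝ → ℝ := fun θ => ‖circlePt (n / (n + 1 : ℕ)) - ∑ j ∈ Finset.range n,
      (circlePt ((j + 1 : ℕ) / (n + 1 : ℕ)) - circlePt (j / (n + 1 : ℕ))) *
      ((if θ < (j + 1 : ℕ) / (n + 1 : ℕ) then 1 else 0 : ℝ) : ℂ) - circlePt θ‖ ^ 2
    have hlim : Tendsto (fun k => ∫ θ, ‖smoothStepFun n (δ k) (trigEval (p k) θ).re -
        circlePt θ‖ ^ 2 ∂μI) atTop (𝓝 (∫ θ, G θ ∂μI)) := by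
      refine tendsto_integral_of_dominated_convergence (fun _ => (1 + n * 2 + 1 : ℝ) ^ 2)
        (fun k => Continuous.aestronglyMeasurable ?_) (integrable_const _)
        (fun k => .of_forall fun θ => ?_) ?_
      · unfold smoothStepFun
        have h1 := fun l => hmeas l k
        have h2 := continuous_circlePt
        fun_prop
      · rw [norm_pow, norm_norm]
        refine pow_le_pow_left₀ (norm_nonneg _) ?_ 2
        refine (norm_sub_le _ _).trans (add_le_add ((norm_sub_le _ _).trans (add_le_add ?_ ?_)) ?_)
        · rw [norm_circlePt]
        · refine (norm_sum_le _ _).trans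
            ((Finset.sum_le_card_nsmul _ _ 2 fun j _ => ?_).trans (by simp))
          rw [norm_mul, Complex.norm_real]
          refine (mul_le_mul (norm_sub_le _ _) (hb _ k _) (norm_nonneg _) (by positivity)).trans ?_
          rw [norm_circlePt, norm_circlePt]
          norm_num
        · rw [norm_circlePt]
      · have hall : ∀ᵐ θ : ℝ ∂μI, ∀ j : ℕ, θ ≠ (j + 1 : ℕ) / (n + 1 : ℕ) :=
          ae_all_iff.2 fun j => hne _
        filter_upwards [hp', hall] with θ h1 h2
        refine ((Tendsto.sub (tendsto_const_nhds.sub (tendsto_finsetSum _ fun j _ =>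
          Tendsto.const_mul _ ?_)) tendsto_const_nhds).norm).pow 2
        exact (Complex.continuous_ofReal.tendsto _).comp (tendsto_ramp (h2 j) h1 hδ hδ0).2
    refine hlim.eventually_lt_const (lt_of_le_of_lt ?_ (lt_add_of_pos_right _ hε))
    have hG : ∀ᵐ θ ∂μI, ‖G θ‖ ≤ (2 * Real.pi / (n + 1 : ℕ)) ^ 2 := by
      filter_upwards [ae_restrict_mem measurableSet_Ioc, hne 1] with θ h1 h2
      rw [norm_pow, norm_norm]
      exact pow_le_pow_left₀ (norm_nonneg _)
        (norm_step_sub_circlePt_le n ⟨h1.1, lt_of_le_of_ne h1.2 h2⟩) 2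
    have := norm_integral_le_of_norm_le_const hG
    simp only [probReal_univ, mul_one] at this
    exact (le_abs_self _).trans this
  obtain ⟨k, h1, h2, h3⟩ := (((Finset.eventually_all _).2 e1).and
    (((Finset.eventually_all _).2 e2).and e3)).exists
  exact ⟨p k, δ k, hδ k, h1, h2, h3⟩


theorem exists_norm_trigEval_le (p : LPoly) : ∃ C : ℝ, 0 < C ∧ ∀ θ, ‖trigEval p θ‖ ≤ C := by
  refine ⟨∑ k ∈ p.coeff.support, ‖p.coeff k‖ + 1, by positivity, fun θ => ?_⟩
  rw [trigEval, AddMonoidAlgebra.lift_apply, Finsupp.sum, Finset.sum_apply]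
  refine ((norm_sum_le _ _).trans (Finset.sum_le_sum fun k _ => ?_)).trans
    (le_add_of_nonneg_right zero_le_one)
  rw [Pi.smul_apply, norm_smul]
  exact mul_le_of_le_one_right (norm_nonneg _) (norm_circlePt _).le

theorem integrable_of_continuous {E : Type*} [NormedAddCommGroup E] {f : ℝ → E}
    (hf : Continuous f) : Integrable f μI :=
  (hf.integrableOn_Icc (μ := volume) (a := 0) (b := 1)).mono_set Set.Ioc_subset_Icc_self

/-! ### Moments and functional calculus in the ultrapower -/

namespace FaithfulNormalTrace

variable {H : Type*} [NormedAddCommGroup H] [InnerProductSpace ℂ H] [CompleteSpace H]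
  {M : VonNeumannAlgebra H} (τ : FaithfulNormalTrace M) (𝒰 : Ultrafilter ℕ)

theorem nontrivial (τ : FaithfulNormalTrace M) : Nontrivial M.toStarSubalgebra :=
  ⟨1, 0, fun h => by simpa [h] using τ.map_one⟩

theorem ultraMk_smul (c : ℂ) (x : BddSeq M) : τ.ultraMk 𝒰 (c • x) = c • τ.ultraMk 𝒰 x := rfl

theorem ultraMk_aeval (x : BddSeq M) (Q : Polynomial ℂ) :
    τ.ultraMk 𝒰 (Polynomial.aeval x Q) = Polynomial.aeval (τ.ultraMk 𝒰 x) Q :=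
  (Polynomial.aeval_algHom_apply (Ideal.Quotient.mkₐ ℂ (τ.nullIdeal 𝒰)) x Q).symm

instance ultrapowerStarModule : StarModule ℂ (τ.Ultrapower 𝒰) where
  star_smul c x := by
    obtain ⟨x, rfl⟩ := τ.ultraMk_surjective 𝒰 x
    rw [← ultraMk_smul, star_ultraMk, star_ultraMk, star_smul, ultraMk_smul]

/-- The trace of the ultrapower as a linear functional. -/
def ultraTraceLin : τ.Ultrapower 𝒰 →ₗ[ℂ] ℂ where
  toFun := τ.ultraTrace 𝒰
  map_add' x y := by
    obtain ⟨x, rfl⟩ := τ.ultraMk_surjective 𝒰 x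
    obtain ⟨y, rfl⟩ := τ.ultraMk_surjective 𝒰 y
    rw [← RingHom.map_add]
    refine tendsto_nhds_unique (τ.tendsto_ultraTrace 𝒰 (x + y)) ?_
    simpa using (τ.tendsto_ultraTrace 𝒰 x).add (τ.tendsto_ultraTrace 𝒰 y)
  map_smul' c x := by
    obtain ⟨x, rfl⟩ := τ.ultraMk_surjective 𝒰 x
    rw [← ultraMk_smul]
    refine tendsto_nhds_unique (τ.tendsto_ultraTrace 𝒰 (c • x)) ?_
    simpa using (τ.tendsto_ultraTrace 𝒰 x).const_mul c

theorem ultraTraceLin_apply (x : τ.Ultrapower 𝒰) : τ.ultraTraceLin 𝒰 x = τ.ultraTrace 𝒰 x := rfl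

theorem ultraTrace_star (x : τ.Ultrapower 𝒰) :
    τ.ultraTrace 𝒰 (star x) = star (τ.ultraTrace 𝒰 x) := by
  obtain ⟨x, rfl⟩ := τ.ultraMk_surjective 𝒰 x
  rw [star_ultraMk]
  refine tendsto_nhds_unique (τ.tendsto_ultraTrace 𝒰 (star x)) ?_
  refine ((continuous_star.tendsto _).comp (τ.tendsto_ultraTrace 𝒰 x)).congr fun n => ?_
  exact (τ.toLin_star (x n)).symm

theorem ultraTrace_one : τ.ultraTrace 𝒰 1 = 1 := by
  rw [← RingHom.map_one (τ.ultraMk 𝒰)]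
  refine tendsto_nhds_unique (τ.tendsto_ultraTrace 𝒰 1) ?_
  simp [τ.map_one]

/-- The powers of a unitary. -/
def unitaryPowers {B : Type*} [Ring B] [StarRing B] (u : unitary B) : Multiplicative ℤ →* B :=
  (unitary B).subtype.comp (zpowersHom _ u)

theorem star_unitaryPowers {B : Type*} [Ring B] [StarRing B] (u : unitary B)
    (k : Multiplicative ℤ) : star (unitaryPowers u k) = unitaryPowers u k⁻¹ := by
  simp only [unitaryPowers, MonoidHom.comp_apply, map_inv]
  rfl

variable {𝒰} {u : τ.Ultrapower 𝒰} (hu : IsHaarUnitary (τ.ultraTrace 𝒰) u)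

/-- The substitution of a Haar unitary of the ultrapower into Laurent polynomials. -/
def haarEval : LPoly →ₐ[ℂ] τ.Ultrapower 𝒰 :=
  AddMonoidAlgebra.lift ℂ _ ℤ (unitaryPowers ⟨u, hu.1⟩)

theorem haarEval_single (k : ℤ) (c : ℂ) :
    τ.haarEval hu (AddMonoidAlgebra.single k c) = c • unitaryPowers ⟨u, hu.1⟩ (.ofAdd k) := by
  rw [haarEval, AddMonoidAlgebra.lift_single]

/-- The Haar condition says that `u` has the moments of Lebesgue measure on the circle; negative
powers follow by taking adjoints. -/
theorem ultraTrace_unitaryPowers (k : ℤ) :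
    τ.ultraTrace 𝒰 (unitaryPowers ⟨u, hu.1⟩ (.ofAdd k)) = ∫ θ, circlePt (k * θ) ∂μI := by
  have hpos : ∀ n : ℕ, 0 < n → τ.ultraTrace 𝒰 (unitaryPowers ⟨u, hu.1⟩ (.ofAdd (n : ℤ))) = 0 := by
    intro n hn
    simpa [unitaryPowers] using hu.2 n hn
  rcases lt_trichotomy k 0 with h | rfl | h
  · rw [integral_circlePt k h.ne]
    obtain ⟨n, hn⟩ := Int.eq_ofNat_of_zero_le (neg_nonneg.2 h.le)
    have h1 := hpos n (by lia)
    rw [← hn, ofAdd_neg, ← star_unitaryPowers, ultraTrace_star, star_eq_zero] at h1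
    exact h1
  · simp [ultraTrace_one, circlePt]
  · rw [integral_circlePt k h.ne']
    obtain ⟨n, rfl⟩ := Int.eq_ofNat_of_zero_le h.le
    exact hpos n (by lia)

theorem ultraTrace_haarEval (p : LPoly) :
    τ.ultraTrace 𝒰 (τ.haarEval hu p) = ∫ θ, trigEval p θ ∂μI := by
  have h1 : ∀ θ, trigEval p θ = ∑ k ∈ p.coeff.support, p.coeff k • circlePt (k * θ) := by
    intro θ
    rw [trigEval, AddMonoidAlgebra.lift_apply, Finsupp.sum, Finset.sum_apply]
    rfl
  simp_rw [h1]
  have hc := continuous_circlePt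
  rw [integral_finsetSum _ fun k _ => integrable_of_continuous (by fun_prop), haarEval,
    AddMonoidAlgebra.lift_apply, Finsupp.sum, ← ultraTraceLin_apply, map_sum]
  refine Finset.sum_congr rfl fun k _ => ?_
  rw [map_smul, ultraTraceLin_apply, integral_smul, ← ultraTrace_unitaryPowers τ hu]

/-- Continuous functional calculus of a lift of a self-adjoint Laurent polynomial in `u`. -/
theorem tendsto_toLin_mul_cfc {l p : LPoly} {y a : BddSeq M} (hy : τ.ultraMk 𝒰 y = τ.haarEval hu l)
    (ha : τ.ultraMk 𝒰 a = τ.haarEval hu p.re) (hsa : ∀ n, IsSelfAdjoint (a n)) {F : ℝ → ℝ}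
    (hF : Continuous F) :
    Tendsto (fun n => τ.toLin (y n * cfc F (a n))) 𝒰
      (𝓝 (∫ θ, trigEval l θ * (F (trigEval p θ).re : ℂ) ∂μI)) := by
  have := τ.nontrivial
  obtain ⟨C, hC0, hC⟩ := exists_norm_trigEval_le l
  obtain ⟨R, hR0, hR⟩ := exists_norm_trigEval_le p
  have hct := continuous_trigEval
  -- For polynomials the claim is algebraic: the product is a lift of a Laurent polynomial in `u`,
  -- whose trace is known.
  have hpoly : ∀ Q : Polynomial ℝ, Tendsto (fun n => τ.toLin (y n * cfc Q.eval (a n))) 𝒰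
      (𝓝 (∫ θ, trigEval l θ * ((Q.eval (trigEval p θ).re : ℝ) : ℂ) ∂μI)) := by
    intro Q
    have h1 := τ.tendsto_ultraTrace 𝒰 (y * Polynomial.aeval a (Q.map (algebraMap ℝ ℂ)))
    rw [RingHom.map_mul, ultraMk_aeval, hy, ha, Polynomial.aeval_algHom_apply, ← map_mul,
      ultraTrace_haarEval] at h1
    convert h1 using 2
    · next n =>
      congr 1
      rw [cfc_polynomial Q (a n) (hsa n), BoundedContinuousFunction.mul_apply]
      congr 1
      have : ∀ P : Polynomial ℂ, (Polynomial.aeval a P) n = Polynomial.aeval (a n) P := by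
        intro P
        induction P using Polynomial.induction_on' with
        | add P P' h h' => simp [h, h']
        | monomial k c => simp [Algebra.algebraMap_eq_smul_one, Polynomial.aeval_monomial]
      rw [this, Polynomial.aeval_map_algebraMap]
    · congr 1
      ext θ
      rw [map_mul, Pi.mul_apply]
      congr 1
      have h2 : ∀ P : Polynomial ℂ, trigEval (Polynomial.aeval p.re P) θ =
          Polynomial.eval (trigEval p.re θ) P := by
        intro P
        rw [← Polynomial.aeval_algHom_apply, Polynomial.aeval_pi_apply₂, Polynomial.coe_aeval_eq_eval]
      rw [h2, trigEval_re, Polynomial.eval_map_algebraMap]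
      exact (Polynomial.aeval_ofReal _ _).symm
  rw [Metric.tendsto_nhds]
  intro ε hε
  -- `[-K, K]` contains both the spectra of all `a n` and the values of the trigonometric
  -- polynomial, so one Weierstrass approximation serves both sides.
  set K := ‖a‖ + R with hK
  set D := ‖y‖ + C with hD
  have hD0 : 0 < D := by positivity
  obtain ⟨Q, hQ⟩ := exists_polynomial_near_of_continuousOn (-K) K F hF.continuousOn
    (ε / (2 * D)) (by positivity)
  have hQc : Continuous fun t => Q.eval t := Q.continuous
  have e1 : ∀ n, ‖τ.toLin (y n * cfc F (a n)) - τ.toLin (y n * cfc Q.eval (a n))‖ ≤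
      ‖y‖ * (ε / (2 * D)) := by
    intro n
    rw [← map_sub, ← mul_sub, ← cfc_sub _ _ (a n) hF.continuousOn hQc.continuousOn]
    refine (τ.norm_toLin_le_norm _).trans ((norm_mul_le _ _).trans ?_)
    refine mul_le_mul (y.norm_coe_le_norm n) (norm_cfc_le (by positivity) fun t ht => ?_)
      (norm_nonneg _) (norm_nonneg _)
    have h1 : ‖t‖ ≤ K := (spectrum.norm_le_norm_of_mem ht).trans
      ((a.norm_coe_le_norm n).trans (by rw [hK]; linarith))
    rw [norm_sub_rev]
    exact (hQ t (abs_le.1 h1)).le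
  have e2 : ‖(∫ θ, trigEval l θ * (F (trigEval p θ).re : ℂ) ∂μI) -
      ∫ θ, trigEval l θ * ((Q.eval (trigEval p θ).re : ℝ) : ℂ) ∂μI‖ ≤ C * (ε / (2 * D)) := by
    rw [← integral_sub (integrable_of_continuous (by fun_prop))
      (integrable_of_continuous (by fun_prop))]
    refine (norm_integral_le_of_norm_le_const (C := C * (ε / (2 * D))) (.of_forall fun θ => ?_)).trans
      (by simp)
    rw [← mul_sub, norm_mul, ← Complex.ofReal_sub, Complex.norm_real]
    refine mul_le_mul (hC θ) ?_ (norm_nonneg _) hC0.le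
    rw [norm_sub_rev]
    have h1 : |(trigEval p θ).re| ≤ K := (Complex.abs_re_le_norm _).trans
      ((hR θ).trans (by rw [hK]; linarith [norm_nonneg a]))
    exact (hQ _ (abs_le.1 h1)).le
  have hsum : ‖y‖ * (ε / (2 * D)) + C * (ε / (2 * D)) = ε / 2 := by
    rw [← add_mul, ← hD]; field_simp
  filter_upwards [Metric.tendsto_nhds.1 (hpoly Q) (ε / 2) (by positivity)] with n hn
  rw [dist_eq_norm] at hn ⊢
  calc _ = ‖(τ.toLin (y n * cfc F (a n)) - τ.toLin (y n * cfc Q.eval (a n))) +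
        (τ.toLin (y n * cfc Q.eval (a n)) -
          ∫ θ, trigEval l θ * ((Q.eval (trigEval p θ).re : ℝ) : ℂ) ∂μI) -
        ((∫ θ, trigEval l θ * (F (trigEval p θ).re : ℂ) ∂μI) -
          ∫ θ, trigEval l θ * ((Q.eval (trigEval p θ).re : ℝ) : ℂ) ∂μI)‖ := by congr 1; ring
    _ ≤ _ := (norm_sub_le _ _).trans (add_le_add (norm_add_le _ _) le_rfl)
    _ < ε := by linarith [e1 n]

end FaithfulNormalTrace


/-! ### Distance from the step approximation to the lift of `u` -/

theorem continuous_smoothStepFun (n : ℕ) {δ : ℝ} (hδ : 0 < δ) :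
    Continuous (smoothStepFun n δ) := by
  unfold smoothStepFun
  have h1 := fun l => continuous_ramp l hδ
  fun_prop

theorem star_mul_self_eq_of_commute {A : Type*} [Ring A] [StarRing A] [Algebra ℂ A]
    [StarModule ℂ A] {a b x : A} (ha : IsSelfAdjoint a) (hb : IsSelfAdjoint b)
    (hab : a * b = b * a) :
    star (a + Complex.I • b - x) * (a + Complex.I • b - x) =
      (a * a + b * b) - (star x * a + Complex.I • (star x * b)) -
        star (star x * a + Complex.I • (star x * b)) + star x * x := by
  simp only [star_sub, star_add, star_smul, star_mul, star_star, ha.star_eq, hb.star_eq,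
    Complex.star_def, Complex.conj_I]
  simp only [sub_mul, mul_sub, add_mul, mul_add, smul_mul_assoc, mul_smul_comm, hab]
  match_scalars <;> ring_nf <;> simp

theorem integral_add_two_mul {X Y Z : ℝ → ℂ} (hX : Integrable X μI) (hY : Integrable Y μI)
    (hZ : Integrable Z μI) : ∫ θ, (X θ - 2 * (Y θ + Complex.I * Z θ) + 1) ∂μI =
      ∫ θ, X θ ∂μI - 2 * (∫ θ, Y θ ∂μI + Complex.I * ∫ θ, Z θ ∂μI) + 1 := by
  have hIZ : Integrable (fun θ => Complex.I * Z θ) μI := hZ.const_mul _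
  have h1 : Integrable (fun θ => 2 * (Y θ + Complex.I * Z θ)) μI := (hY.add hIZ).const_mul _
  have h2 : Integrable (fun θ => X θ - 2 * (Y θ + Complex.I * Z θ)) μI := hX.sub h1
  rw [integral_add h2 (integrable_const _), integral_sub hX h1, integral_const_mul,
    integral_add hY hIZ, integral_const_mul]
  simp

namespace FaithfulNormalTrace

variable {H : Type*} [NormedAddCommGroup H] [InnerProductSpace ℂ H] [CompleteSpace H]
  {M : VonNeumannAlgebra H}

/-- Splitting into real and imaginary parts brings the complex-valued step function within reach of
the real functional calculus. -/
theorem smoothStep_eq {a : M.toStarSubalgebra} (ha : IsSelfAdjoint a) (n : ℕ) {δ : ℝ}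
    (hδ : 0 < δ) : smoothStep n δ a = cfc (fun t => (smoothStepFun n δ t).re) a +
      Complex.I • cfc (fun t => (smoothStepFun n δ t).im) a := by
  have hc := fun l => (continuous_ramp l hδ).continuousOn (s := spectrum ℝ a)
  have key : ∀ (d : ℝ) (c : ℕ → ℝ), cfc (fun t => d - ∑ j ∈ Finset.range n,
      c j * ramp ((j + 1 : ℕ) / (n + 1 : ℕ) - δ) δ t) a = (d : ℂ) • 1 - ∑ j ∈ Finset.range n,
      (c j : ℂ) • cfc (ramp ((j + 1 : ℕ) / (n + 1 : ℕ) - δ) δ) a := by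
    intro d c
    have e : (fun t => d - ∑ j ∈ Finset.range n,
        c j * ramp ((j + 1 : ℕ) / (n + 1 : ℕ) - δ) δ t) = fun t => (fun _ => d) t -
        (∑ j ∈ Finset.range n, fun t => c j * ramp ((j + 1 : ℕ) / (n + 1 : ℕ) - δ) δ t) t := by
      ext t
      simp [Finset.sum_apply]
    have hcj : ∀ j ∈ Finset.range n, ContinuousOn
        (fun t => c j * ramp ((j + 1 : ℕ) / (n + 1 : ℕ) - δ) δ t) (spectrum ℝ a) :=
      fun j _ => continuousOn_const.mul (hc _)
    have hcs : ContinuousOn (∑ j ∈ Finset.range n,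
        fun t => c j * ramp ((j + 1 : ℕ) / (n + 1 : ℕ) - δ) δ t) (spectrum ℝ a) := by
      rw [show (∑ j ∈ Finset.range n, fun t => c j * ramp ((j + 1 : ℕ) / (n + 1 : ℕ) - δ) δ t) =
        fun t => ∑ j ∈ Finset.range n, c j * ramp ((j + 1 : ℕ) / (n + 1 : ℕ) - δ) δ t by
          ext t; simp [Finset.sum_apply]]
      exact continuousOn_finsetSum _ hcj
    rw [e, cfc_sub _ _ a continuousOn_const hcs, cfc_const d a ha, cfc_sum _ _ _ hcj,
      Algebra.algebraMap_eq_smul_one, Complex.coe_smul]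
    congr 1
    refine Finset.sum_congr rfl fun j _ => ?_
    rw [cfc_const_mul _ _ _ (hc _), Complex.coe_smul]
  set d := circlePt (n / (n + 1 : ℕ)) with hd
  set c : ℕ → ℂ := fun j => circlePt ((j + 1 : ℕ) / (n + 1 : ℕ)) - circlePt (j / (n + 1 : ℕ))
    with hcdef
  have hre : (fun t => (smoothStepFun n δ t).re) = fun t => d.re - ∑ j ∈ Finset.range n,
      (c j).re * ramp ((j + 1 : ℕ) / (n + 1 : ℕ) - δ) δ t := by
    ext t
    rw [smoothStepFun, Complex.sub_re, Complex.re_sum]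
    simp only [Complex.re_mul_ofReal]
    rfl
  have him : (fun t => (smoothStepFun n δ t).im) = fun t => d.im - ∑ j ∈ Finset.range n,
      (c j).im * ramp ((j + 1 : ℕ) / (n + 1 : ℕ) - δ) δ t := by
    ext t
    rw [smoothStepFun, Complex.sub_im, Complex.im_sum]
    simp only [Complex.im_mul_ofReal]
    rfl
  rw [hre, him, key, key, smul_sub, Finset.smul_sum, sub_add_sub_comm, ← Finset.sum_add_distrib,
    smul_smul, ← add_smul]
  simp_rw [smul_smul, ← add_smul]
  have h3 : ∀ z : ℂ, (z.re : ℂ) + Complex.I * z.im = z := fun z => by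
    rw [mul_comm]; exact Complex.re_add_im z
  simp_rw [h3]
  rfl

variable (τ : FaithfulNormalTrace M) {𝒰 : Ultrafilter ℕ} {u : τ.Ultrapower 𝒰}
  (hu : IsHaarUnitary (τ.ultraTrace 𝒰) u)

/-- Expand the square into `τ(|F(a)|²) - 2 Re τ(x⋆F(a)) + τ(x⋆x)`. The sequences `1` and `x⋆` lift
`1` and `u⁻¹`, so the first two traces converge to integrals against `1` and `exp(-2πiθ)`; the last
tends to `1`. -/
theorem tendsto_norm2_smoothStep_sub_sq {p : LPoly} {x a : BddSeq M} (hx : τ.ultraMk 𝒰 x = u)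
    (ha : τ.ultraMk 𝒰 a = τ.haarEval hu p.re) (hsa : ∀ n, IsSelfAdjoint (a n)) (N : ℕ) {δ : ℝ}
    (hδ : 0 < δ) :
    Tendsto (fun n => τ.norm2 (smoothStep N δ (a n) - x n) ^ 2) 𝒰
      (𝓝 (∫ θ, ‖smoothStepFun N δ (trigEval p θ).re - circlePt θ‖ ^ 2 ∂μI)) := by
  set F : ℝ → ℂ := smoothStepFun N δ with hF
  have hFc : Continuous F := continuous_smoothStepFun N hδ
  have hct := continuous_trigEval p
  have hcc := continuous_circlePt
  have hone : τ.ultraMk 𝒰 1 = τ.haarEval hu (AddMonoidAlgebra.single 0 1) := by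
    rw [RingHom.map_one, haarEval_single]
    simp
  have hstar : τ.ultraMk 𝒰 (star x) = τ.haarEval hu (AddMonoidAlgebra.single (-1) 1) := by
    rw [haarEval_single, one_smul, ofAdd_neg, ← star_unitaryPowers, ← star_ultraMk, hx]
    simp [unitaryPowers]
  have t1 := τ.tendsto_toLin_mul_cfc hu hone ha hsa
    (F := fun t => (F t).re * (F t).re + (F t).im * (F t).im) (by fun_prop)
  have t2 := τ.tendsto_toLin_mul_cfc hu hstar ha hsa (F := fun t => (F t).re) (by fun_prop)
  have t3 := τ.tendsto_toLin_mul_cfc hu hstar ha hsa (F := fun t => (F t).im) (by fun_prop)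
  have t4 : Tendsto (fun n => τ.toLin (star (x n) * x n)) 𝒰 (𝓝 1) := by
    have h := τ.tendsto_ultraTrace 𝒰 (star x * x)
    rw [RingHom.map_mul, ← star_ultraMk, hx, Unitary.star_mul_self_of_mem hu.1, ultraTrace_one] at h
    exact h
  have hlim := ((Complex.continuous_re.tendsto _).comp ((t1.sub
    ((t2.add (t3.const_mul Complex.I)).const_mul 2)).add t4))
  refine (hlim.congr fun n => ?_).trans (le_of_eq (congrArg 𝓝 ?_))
  · have hcr : ContinuousOn (fun t => (F t).re) (spectrum ℝ (a n)) := by fun_prop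
    have hci : ContinuousOn (fun t => (F t).im) (spectrum ℝ (a n)) := by fun_prop
    rw [norm2_sq, smoothStep_eq (hsa n) N hδ]
    simp only [Function.comp_apply, BoundedContinuousFunction.coe_one, Pi.one_apply, one_mul]
    rw [cfc_add (a n) (fun t => (F t).re * (F t).re) (fun t => (F t).im * (F t).im) (hcr.mul hcr)
      (hci.mul hci), cfc_mul _ _ _ hcr hcr, cfc_mul _ _ _ hci hci]
    have hA1 : IsSelfAdjoint (cfc (fun t => (F t).re) (a n)) := cfc_predicate _ _
    have hA2 : IsSelfAdjoint (cfc (fun t => (F t).im) (a n)) := cfc_predicate _ _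
    have hcomm : cfc (fun t => (F t).re) (a n) * cfc (fun t => (F t).im) (a n) =
      cfc (fun t => (F t).im) (a n) * cfc (fun t => (F t).re) (a n) := cfc_commute_cfc _ _ _
    set A1 := cfc (fun t => (F t).re) (a n)
    set A2 := cfc (fun t => (F t).im) (a n)
    rw [star_mul_self_eq_of_commute hA1 hA2 hcomm]
    simp only [BoundedContinuousFunction.star_apply, map_add, map_sub, toLin_star, map_smul,
      Complex.star_def, Complex.add_re, Complex.sub_re, Complex.conj_re, smul_eq_mul]
    simp
    ring
  · have hX : Integrable (fun θ => (((F (trigEval p θ).re).re * (F (trigEval p θ).re).re +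
        (F (trigEval p θ).re).im * (F (trigEval p θ).re).im : ℝ) : ℂ)) μI :=
      integrable_of_continuous (by fun_prop)
    have hY : Integrable (fun θ => circlePt (-θ) * ((F (trigEval p θ).re).re : ℂ)) μI :=
      integrable_of_continuous (by fun_prop)
    have hZ : Integrable (fun θ => circlePt (-θ) * ((F (trigEval p θ).re).im : ℂ)) μI :=
      integrable_of_continuous (by fun_prop)
    have hpt : ∀ θ, ‖F (trigEval p θ).re - circlePt θ‖ ^ 2 =
        ((((F (trigEval p θ).re).re * (F (trigEval p θ).re).re +
        (F (trigEval p θ).re).im * (F (trigEval p θ).re).im : ℝ) : ℂ) -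
        2 * (circlePt (-θ) * ((F (trigEval p θ).re).re : ℂ) +
          Complex.I * (circlePt (-θ) * ((F (trigEval p θ).re).im : ℂ))) + 1).re := by
      intro θ
      have h1 : circlePt (-θ) = star (circlePt θ) := by
        refine (left_inv_eq_right_inv (star_circlePt_mul_self θ) ?_).symm
        rw [← circlePt_add]
        simp [circlePt]
      have h2 : (circlePt θ).re * (circlePt θ).re + (circlePt θ).im * (circlePt θ).im = 1 := by
        rw [← Complex.normSq_apply, Complex.normSq_eq_norm_sq, norm_circlePt, one_pow]
      rw [h1, ← Complex.normSq_eq_norm_sq, Complex.normSq_apply]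
      simp
      linear_combination h2
    have hI : Integrable (fun θ => ((((F (trigEval p θ).re).re * (F (trigEval p θ).re).re +
        (F (trigEval p θ).re).im * (F (trigEval p θ).re).im : ℝ) : ℂ) -
        2 * (circlePt (-θ) * ((F (trigEval p θ).re).re : ℂ) +
          Complex.I * (circlePt (-θ) * ((F (trigEval p θ).re).im : ℂ))) + 1)) μI :=
      (hX.sub ((hY.add (hZ.const_mul _)).const_mul _)).add (integrable_const _)
    have hre := Complex.reCLM.integral_comp_comm hI
    simp only [Complex.reCLM_apply] at hre
    simp_rw [hpt]
    rw [hre, integral_add_two_mul hX hY hZ]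
    simp only [trigEval_single, one_mul, Int.cast_zero, zero_mul, Int.cast_neg, Int.cast_one, neg_mul]
    simp [circlePt]

/-- The constants are fixed in the order mesh, tolerance `η`, polynomial and ramp width; only then
is `n` restricted, by finitely many conditions. -/
theorem eventually_exists_haar_near (hu : IsHaarUnitary (τ.ultraTrace 𝒰) u) (hM : IsDiffuse M)
    {x : BddSeq M} (hx : τ.ultraMk 𝒰 x = u)
    {ε : ℝ} (hε : 0 < ε) : ∀ᶠ n in 𝒰, ∃ v ∈ τ.haarUnitaries, τ.norm2 (v - x n) < ε := by
  -- The mesh error is paid twice: between the Haar unitary and its step element, and between the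
  -- step approximation and `x n`.
  obtain ⟨m, hm⟩ : ∃ m : ℕ, 2 * (2 * Real.pi / 2 ^ m) < ε := by
    have : Tendsto (fun m : ℕ => 2 * (2 * Real.pi / 2 ^ m)) atTop (𝓝 0) := by
      have := (tendsto_pow_atTop_nhds_zero_of_lt_one (r := (1 / 2 : ℝ)) (by norm_num)
        (by norm_num)).const_mul (2 * (2 * Real.pi))
      rw [mul_zero] at this
      refine this.congr fun m => ?_
      rw [one_div, inv_pow]
      ring
    exact (this.eventually_lt_const hε).exists
  obtain ⟨N, hN⟩ : ∃ N : ℕ, N + 1 = 2 ^ m := ⟨2 ^ m - 1, by have := Nat.one_le_two_pow (n := m); lia⟩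
  have hN' : ((N + 1 : ℕ) : ℝ) = 2 ^ m := by exact_mod_cast hN
  obtain ⟨η, hη, hη0⟩ : ∃ η : ℝ, 2 * Real.pi / 2 ^ m + N * (2 * (2 * √(2 * η))) +
      √((2 * Real.pi / 2 ^ m) ^ 2 + η) < ε ∧ 0 < η := by
    have hc : Continuous fun η : ℝ => 2 * Real.pi / 2 ^ m + N * (2 * (2 * √(2 * η))) +
      √((2 * Real.pi / 2 ^ m) ^ 2 + η) := by fun_prop
    have h0 := hc.tendsto 0
    have h1 : 2 * Real.pi / 2 ^ m + N * (2 * (2 * √(2 * 0))) +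
        √((2 * Real.pi / 2 ^ m) ^ 2 + 0) < ε := by
      rw [mul_zero, Real.sqrt_zero, add_zero, Real.sqrt_sq (by positivity)]
      linarith
    exact (((h0.mono_left nhdsWithin_le_nhds).eventually_lt_const h1).and
      (self_mem_nhdsWithin (s := Set.Ioi 0))).exists
  obtain ⟨p, δ, hδ, h1, h2, h3⟩ := exists_trig_approx N hη0
  obtain ⟨b, hb⟩ := τ.ultraMk_surjective 𝒰 (τ.haarEval hu p.re)
  -- Symmetrising keeps the class and makes every coordinate self-adjoint.
  let a : BddSeq M := (2⁻¹ : ℂ) • (b + star b)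
  have ha : τ.ultraMk 𝒰 a = τ.haarEval hu p.re := by
    have hs : star (τ.haarEval hu p.re) = τ.haarEval hu p.re :=
      star_lift_re (star_unitaryPowers _) p
    rw [ultraMk_smul, RingHom.map_add, ← star_ultraMk, hb, hs, ← two_smul ℂ, smul_smul,
      inv_mul_cancel₀ two_ne_zero, one_smul]
  have hsa : ∀ n, IsSelfAdjoint (a n) := by
    intro n
    change star ((2⁻¹ : ℂ) • (b n + star (b n))) = (2⁻¹ : ℂ) • (b n + star (b n))
    rw [star_smul, star_add, star_star, add_comm]
    congr 1
    simp
  have hone : τ.ultraMk 𝒰 1 = τ.haarEval hu (AddMonoidAlgebra.single 0 1) := by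
    rw [RingHom.map_one, haarEval_single]
    simp
  have ht : ∀ l, Tendsto (fun n => (τ.toLin (cfc (ramp l δ) (a n))).re) 𝒰
      (𝓝 (∫ θ, ramp l δ (trigEval p θ).re ∂μI)) := by
    intro l
    have := (Complex.continuous_re.tendsto _).comp
      (τ.tendsto_toLin_mul_cfc hu hone ha hsa (continuous_ramp l hδ))
    simp only [trigEval_single, Int.cast_zero, zero_mul, one_mul] at this
    simpa [Function.comp_def, circlePt, integral_complex_ofReal] using this
  have f1 : ∀ j ∈ Finset.range N, ∀ᶠ n in 𝒰,
      |(τ.toLin (cfc (ramp ((j + 1 : ℕ) / (N + 1 : ℕ) - δ) δ) (a n))).re -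
        (j + 1 : ℕ) / (N + 1 : ℕ)| < η := fun j hj =>
    ((ht _).sub_const _).abs.eventually_lt_const (h1 j hj)
  have f2 : ∀ j ∈ Finset.range N, ∀ᶠ n in 𝒰,
      |(τ.toLin (cfc (ramp ((j + 1 : ℕ) / (N + 1 : ℕ)) δ) (a n))).re -
        (j + 1 : ℕ) / (N + 1 : ℕ)| < η := fun j hj =>
    ((ht _).sub_const _).abs.eventually_lt_const (h2 j hj)
  have f3 := (τ.tendsto_norm2_smoothStep_sub_sq hu hx ha hsa N hδ).eventually_lt_const h3
  filter_upwards [(Finset.eventually_all _).2 f1, (Finset.eventually_all _).2 f2, f3] with n g1 g2 g3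
  obtain ⟨v, hv, hvn⟩ := τ.exists_haar_near_smoothStep hM (hsa n) hN hδ
    (fun j hj => (g1 j hj).le) (fun j hj => (g2 j hj).le)
  refine ⟨v, hv, ?_⟩
  rw [hN'] at g3
  have g4 := Real.le_sqrt_of_sq_le g3.le
  linarith [τ.norm2_sub_le v (smoothStep N δ (a n)) (x n)]

/-- For unitaries `‖d - v‖₂² = 2 - 2 Re τ(v⋆d)`, and normality on the unit ball sends `τ(v⋆d)` to
`1` as `d` tends strongly to `v`. -/
theorem exists_mem_norm2_sub_lt {D : Set M.toStarSubalgebra}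
    (hD : IsSOTDenseSubset D τ.haarUnitaries) {v : M.toStarSubalgebra} (hv : v ∈ τ.haarUnitaries)
    {ε : ℝ} (hε : 0 < ε) : ∃ d ∈ D, τ.norm2 (d - v) < ε := by
  have hcl := hD.2 ⟨v, hv, rfl⟩
  rw [mem_closure_iff_comap_neBot] at hcl
  set v' := ContinuousLinearMap.toPointwiseConvergenceCLM ℂ (RingHom.id ℂ) H H (v : H →L[ℂ] H)
  set l := comap ((↑) : toSOT D → H →Lₚₜ[ℂ] H) (𝓝 v') with hl
  choose d hd hdi using fun i : toSOT D => i.2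
  have hunit : ∀ i, d i ∈ unitary M.toStarSubalgebra := fun i => (hD.1 (hd i)).1
  have hpt : ∀ w, Tendsto (fun i => (d i).1 w) l (𝓝 (v.1 w)) := by
    intro w
    have h1 := ((PointwiseConvergenceCLM.evalCLM (RingHom.id ℂ) H w).continuous.tendsto v').comp
      (tendsto_comap (f := ((↑) : toSOT D → H →Lₚₜ[ℂ] H)))
    refine h1.congr fun i => ?_
    rw [Function.comp_apply, ← hdi i]
    rfl
  have := τ.nontrivial
  have ht := τ.tendsto_toLin_of_tendsto_apply (l := l) (x := fun i => star v * d i)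
    (y := star v * v) (fun i => (CStarRing.norm_of_mem_unitary
      (mul_mem (Unitary.star_mem hv.1) (hunit i))).le)
    (fun w => ((star v).1.continuous.tendsto _).comp (hpt w))
  have hsq : Tendsto (fun i => τ.norm2 (d i - v) ^ 2) l (𝓝 0) := by
    have h2 := ((Complex.continuous_re.tendsto _).comp ht).const_mul 2 |>.const_sub 2
    rw [Unitary.star_mul_self_of_mem hv.1, τ.map_one, Complex.one_re, mul_one, sub_self] at h2
    refine h2.congr fun i => ?_
    have e : star (d i - v) * (d i - v) = 1 - star (star v * d i) - star v * d i + 1 := by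
      rw [star_sub, sub_mul, mul_sub, mul_sub, Unitary.star_mul_self_of_mem hv.1,
        Unitary.star_mul_self_of_mem (hunit i), star_mul, star_star]
      abel
    rw [norm2_sq, e, map_add, map_sub, map_sub, toLin_star, τ.map_one]
    simp
    ring
  have h0 : Tendsto (fun i => τ.norm2 (d i - v)) l (𝓝 0) := by
    have := (Real.continuous_sqrt.tendsto 0).comp hsq
    simpa [Function.comp_def, Real.sqrt_sq (τ.norm2_nonneg _)] using this
  obtain ⟨i, hi⟩ := (h0.eventually_lt_const hε).exists
  exact ⟨d i, hd i, hi⟩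

end FaithfulNormalTrace

end TracialVN

end

/-! ### Selecting the sequence in `D` -/

theorem mainTheorem10 {H : Type*} [NormedAddCommGroup H] [InnerProductSpace ℂ H] [CompleteSpace H]
    (M : VonNeumannAlgebra H) (hM : TracialVN.IsDiffuse M)
    (τ : TracialVN.FaithfulNormalTrace M)
    (D : Set M.toStarSubalgebra) (hD : TracialVN.IsSOTDenseSubset D τ.haarUnitaries)
    (𝒰 : Ultrafilter ℕ) (h𝒰 : ∀ n : ℕ, 𝒰 ≠ pure n)
    (u : τ.Ultrapower 𝒰) (hu : TracialVN.IsHaarUnitary (τ.ultraTrace 𝒰) u) :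
    ∃ d : ℕ →ᵇ M.toStarSubalgebra, (∀ n : ℕ, d n ∈ D) ∧ τ.ultraMk 𝒰 d = u := by
  obtain ⟨x, hx⟩ := τ.ultraMk_surjective 𝒰 u
  have hnear : ∀ ε > 0, ∀ᶠ n in 𝒰, ∃ d ∈ D, τ.norm2 (d - x n) < ε := by
    intro ε hε
    filter_upwards [τ.eventually_exists_haar_near hu hM hx (half_pos hε)] with n ⟨v, hv, hvn⟩
    obtain ⟨d, hd, hdv⟩ := τ.exists_mem_norm2_sub_lt hD hv (half_pos hε)
    exact ⟨d, hd, by linarith [τ.norm2_sub_le d v (x n)]⟩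
  obtain ⟨_, d₀, hd₀, -⟩ := (hnear 1 one_pos).exists
  -- A point that is optimal up to `1 / (n + 1)` beats every `ε`-dependent choice at once, so no
  -- diagonal argument is needed.
  have hchoice : ∀ n : ℕ, ∃ d ∈ D, ∀ d' ∈ D,
      τ.norm2 (d - x n) < τ.norm2 (d' - x n) + 1 / ((n : ℝ) + 1) := by
    intro n
    have hne : ((fun d => τ.norm2 (d - x n)) '' D).Nonempty := ⟨_, d₀, hd₀, rfl⟩
    have hbdd : BddBelow ((fun d => τ.norm2 (d - x n)) '' D) :=
      ⟨0, by rintro _ ⟨d, -, rfl⟩; exact τ.norm2_nonneg _⟩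
    obtain ⟨_, ⟨d, hd, rfl⟩, hlt⟩ := exists_lt_of_csInf_lt hne
      (lt_add_of_pos_right _ (Nat.one_div_pos_of_nat (α := ℝ) (n := n)))
    exact ⟨d, hd, fun d' hd' => hlt.trans_le
      (add_le_add_left (csInf_le hbdd ⟨d', hd', rfl⟩) _)⟩
  choose d hdD hd using hchoice
  have := τ.nontrivial
  refine ⟨BoundedContinuousFunction.ofNormedAddCommGroupDiscrete d 1 fun n =>
    (CStarRing.norm_of_mem_unitary (hD.1 (hdD n)).1).le, hdD, ?_⟩
  rw [← hx, τ.ultraMk_eq_iff]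
  -- Freeness of `𝒰` makes the slack `1 / (n + 1)` tend to zero along it.
  have hcof : (𝒰 : Filter ℕ) ≤ Filter.atTop := by
    rw [← Nat.cofinite_eq_atTop]
    exact 𝒰.le_cofinite_or_eq_pure.resolve_right fun ⟨n, hn⟩ => h𝒰 n hn
  rw [Metric.tendsto_nhds]
  intro ε hε
  filter_upwards [hnear (ε / 2) (half_pos hε),
    (tendsto_one_div_add_atTop_nhds_zero_nat.mono_left hcof).eventually_lt_const
      (half_pos hε)] with n ⟨d', hd', hlt⟩ hn
  rw [Real.dist_eq, sub_zero, abs_of_nonneg (τ.norm2_nonneg _)]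
  have := hd n d' hd'
  change τ.norm2 (d n - x n) < ε
  linarith
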